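/- **Dual numbers and orders.** Let $\mathcal R^{(2)}=\mathbb R\oplus\mathbb R\,1^{\#}$ with $1^{\#}1^{\#}=0$ be the dual real numbers, and write $x=\mathrm{Re}\,x+(\mathrm{Ze}\,x)1^{\#}$. For $\theta\in\{1,2\}$ write $x\le_\theta y$ if $\mathrm{Re}\,x\le\mathrm{Re}\,y$ and $(-1)^{\theta-1}\mathrm{Ze}\,x\le(-1)^{\theta-1}\mathrm{Ze}\,y$, write $x<_\theta y$ if moreover $x\neq y$, and let $[a,b]_\theta=\{x: a\le_\theta x\le_\theta b\}$. **Type $\theta$ integral.** A partition of $[a^1,b^1]_\theta\times\cdots\times[a^k,b^k]_\theta$ (where $a^i<_\theta b^i$) consists of a finite chain $a^i=x^{i(0)}<_\theta\cdots<_\theta x^{i(N_i)}=b^i$ for each $i$. Its subrectangles are $S=\prod_i[x^{i(j_i-1)},x^{i(j_i)}]_\theta$, with $v(S)=\prod_i(x^{i(j_i)}-x^{i(j_i-1)})\in\mathcal R^{(2)}$. For a bounded function $f=f_{Re}+f_{Ze}1^{\#}$ put $U_1(P,f)=\sum_S(\sup_S f_{Re}+1^{\#}\sup_S f_{Ze})v(S)$,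 $L_1(P,f)=\sum_S(\inf_S f_{Re}+1^{\#}\inf_S f_{Ze})v(S)$, $U_2(P,f)=\sum_S(\sup_S f_{Re}+1^{\#}\inf_S f_{Ze})v(S)$, $L_2(P,f)=\sum_S(\inf_S f_{Re}+1^{\#}\sup_S f_{Ze})v(S)$. The upper integral is $\inf_P\mathrm{Re}\,U_1+1^{\#}\inf_P\mathrm{Ze}\,U_1$ for $\theta=1$ and $\inf_P\mathrm{Re}\,U_2+1^{\#}\sup_P\mathrm{Ze}\,U_2$ for $\theta=2$. The lower integral is $\sup_P\mathrm{Re}\,L_1+1^{\#}\sup_P\mathrm{Ze}\,L_1$ for $\theta=1$ and $\sup_P\mathrm{Re}\,L_2+1^{\#}\inf_P\mathrm{Ze}\,L_2$ for $\theta=2$. The function $f$ is type $\theta$ integrable if it is bounded and these agree; the common value is its type $\theta$ integral. **Differentiation and forms.** Put $\|x\|^2=\sum_i\big(2(\mathrm{Re}\,x^i)^2+(\mathrm{Ze}\,x^i)^2\big)$ on $(\mathcal R^{(2)})^n$. A map $f$ from an open subset of $(\mathcal R^{(2)})^n$ to $(\mathcal R^{(2)})^m$ is dual real differentiable at $a$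 if there is an $\mathcal R^{(2)}$-linear map $\mathcal Df(a)$ with $\|f(x)-f(a)-\mathcal Df(a)(x-a)\|/\|x-a\|\to0$ as $x\to a$. A dual real differentiable $k$-form on an open set $A$ is $w=\sum_{i_1<\dots<i_k}w_{i_1\dots i_k}\,dx^{i_1}\wedge\cdots\wedge dx^{i_k}$ with dual real differentiable coefficients on $A$, where $w(p)$ is an alternating $\mathcal R^{(2)}$-multilinear $k$-tensor. Put $dw=\sum dw_{i_1\dots i_k}\wedge dx^{i_1}\wedge\cdots\wedge dx^{i_k}$, where $df(p)=\mathcal Df(p)$. The pullback $g^*w$ is defined by $(g^*w)(p)(v_1,\dots,v_k)=w(g(p))(\mathcal Dg(p)v_1,\dots,\mathcal Dg(p)v_k)$. **Cubes and chains.** Fix $r\ge0$ and $b=1+(-1)^{\theta-1}r\,1^{\#}$. A type $\theta$ singular $k$-cube in $A$ is a function $c:[0,b]_\theta^k\to A$ that extends to a dual real differentiable function $g$ on an open set containing $[0,b]_\theta^k$, such that $\mathcal Dg$ is dual real differentiable as well (that is, $p\mapsto\mathcal Dg(p)(v)$ is dual real differentiable for each $v$). A $0$-cube is a point of $A$. A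 type $\theta$ $k$-chain in $A$ is a finite formal sum of such cubes with integer coefficients. The boundary is the additive extension of $\partial c=\sum_{j=1}^k\sum_{\alpha=0,1}(-1)^{j+\alpha}c_{(j,\alpha)}$, where $c_{(j,\alpha)}(x^1,\dots,x^{k-1})=c(x^1,\dots,x^{j-1},\alpha b,x^j,\dots,x^{k-1})$. For $k\ge1$, $\int_c w$ is the type $\theta$ integral over $[0,b]_\theta^k$ of the function $f$ with $c^*w=f\,dx^1\wedge\cdots\wedge dx^k$, where $\mathcal Dc$ means the derivative of an extension (which is determined by $c$ on $[0,b]^k_\theta$). For $k=0$, $\int_c w=w(c(0))$. For chains, $\int_{\sum a_ic_i}w=\sum a_i\int_{c_i}w$. **Theorem (type $\theta$ Stokes' theorem).** Let $k\ge1$, let $A\subseteq(\mathcal R^{(2)})^n$ be open, and let $w$ be a dual real differentiable $(k-1)$-form on $A$ whose differential $dw$ is a dual real differentiable $k$-form on $A$. Let $c$ be a type $\theta$ $k$-chain in $A$. Then the integrals of $dw$ over the cubes of $c$ and of $w$ over the cubes of $\partial c$ all exist, and $$\int_c dw=\int_{\partial c}w.$$ -/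

import Mathlib

open Filter Topology
open scoped Nat NNReal DualNumber

noncomputable section

namespace DualStokes

/-! ### Dual real numbers, the two orders, dual real space -/

/-- The dual real numbers `ℝ ⊕ ℝ 1^#` with `1^# * 1^# = 0`, with their usual (product) topology. -/
abbrev Dual : Type := DualNumber ℝ

/-- The dual real `n`-space, a module over the dual real numbers. -/
abbrev Space (n : ℕ) : Type := Fin n → Dual

/-- The real part. -/
def Re (x : Dual) : ℝ := TrivSqZeroExt.fst x

/-- The zero-divisor part. -/
def Ze (x : Dual) : ℝ := TrivSqZeroExt.snd x

/-- The dual number `a + c 1^#`. -/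
def mkDual (a c : ℝ) : Dual := TrivSqZeroExt.inl a + TrivSqZeroExt.inr c

/-- The letter `θ`, which takes the two values 1 and 2. -/
inductive Kind
  | one
  | two

/-- `(-1)^(θ-1)`. -/
def Kind.sgn : Kind → ℝ
  | .one => 1
  | .two => -1

/-- `x` is type `θ` less than `y`. -/
def TLt : Kind → Dual → Dual → Prop
  | .one, x, y => (Re x < Re y ∧ Ze x ≤ Ze y) ∨ (Re x = Re y ∧ Ze x < Ze y)
  | .two, x, y => (Re x < Re y ∧ Ze y ≤ Ze x) ∨ (Re x = Re y ∧ Ze y < Ze x)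

/-- `x` is type `θ` less than or equal to `y`. -/
def TLe (θ : Kind) (x y : Dual) : Prop := TLt θ x y ∨ x = y

/-- The type `θ` closed interval. -/
def TIcc (θ : Kind) (a b : Dual) : Set Dual := {x | TLe θ a x ∧ TLe θ x b}

/-- The norm `(2 ∑ (x^{i1})² + ∑ (x^{i2})²)^{1/2}`.  It induces the product topology. -/
def dnorm {n : ℕ} (x : Space n) : ℝ :=
  Real.sqrt (2 * ∑ i, Re (x i) ^ 2 + ∑ i, Ze (x i) ^ 2)

/-! ### Dual real differentiation -/

/-- `f` is dual real differentiable at `a`, with dual real derivative the module map `L`. -/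
def HasDualDeriv {n m : ℕ} (f : Space n → Space m) (L : Space n →ₗ[Dual] Space m)
    (a : Space n) : Prop :=
  Tendsto (fun x => dnorm (f x - f a - L (x - a)) / dnorm (x - a)) (𝓝[≠] a) (𝓝 0)

/-- `f` is dual real differentiable on (the open set) `U`. -/
def DualDiffOn {n m : ℕ} (f : Space n → Space m) (U : Set (Space n)) : Prop :=
  ∀ a ∈ U, ∃ L : Space n →ₗ[Dual] Space m, HasDualDeriv f L a

open Classical in
/-- The dual real derivative `𝓓 f (a)` (zero where `f` is not dual real differentiable). -/
def dualDeriv {n m : ℕ} (f : Space n → Space m) (a : Space n) : Space n →ₗ[Dual] Space m :=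
  if h : ∃ L : Space n →ₗ[Dual] Space m, HasDualDeriv f L a then h.choose else 0

/-- A dual-valued function, seen as a function into dual real `1`-space. -/
def toSpaceOne {n : ℕ} (f : Space n → Dual) : Space n → Space 1 := fun x _ => f x

/-- `f` is dual real differentiable on the open set `U`, and so is its dual real derivative
(that is, all the functions `a ↦ 𝓓 f (a) (v)`). -/
def TwiceDualDiffOn {n m : ℕ} (f : Space n → Space m) (U : Set (Space n)) : Prop :=
  ∃ L : Space n → (Space n →ₗ[Dual] Space m),
    (∀ a ∈ U, HasDualDeriv f (L a) a) ∧ ∀ v, DualDiffOn (fun a => L a v) U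

/-! ### Type `θ` integration -/

/-- A partition `a = x⁽⁰⁾ < x⁽¹⁾ < ⋯ < x⁽ᴺ⁾ = b` of a type `θ` interval, for the type `θ` order. -/
structure TPartition (θ : Kind) (a b : Dual) where
  N : ℕ
  pt : Fin (N + 1) → Dual
  pt_zero : pt 0 = a
  pt_last : pt (Fin.last N) = b
  lt : ∀ i : Fin N, TLt θ (pt i.castSucc) (pt i.succ)

/-- The type `θ` closed rectangle `∏ [a i, b i]_θ`. -/
def TRect (θ : Kind) {n : ℕ} (a b : Space n) : Set (Space n) := {x | ∀ i, x i ∈ TIcc θ (a i) (b i)}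

/-- A partition of a type `θ` closed rectangle. -/
abbrev RectPartition (θ : Kind) {n : ℕ} (a b : Space n) : Type :=
  (i : Fin n) → TPartition θ (a i) (b i)

section sums

variable {θ : Kind} {n : ℕ} {a b : Space n}

/-- The indices of the subrectangles of a partition. -/
abbrev RectPartition.Index (P : RectPartition θ a b) : Type := (i : Fin n) → Fin (P i).N

/-- The subrectangles of a partition. -/
def RectPartition.sub (P : RectPartition θ a b) (j : RectPartition.Index P) : Set (Space n) :=
  TRect θ (fun i => (P i).pt (j i).castSucc) (fun i => (P i).pt (j i).succ)

/-- The dual real volume of a subrectangle. -/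
def RectPartition.vol (P : RectPartition θ a b) (j : RectPartition.Index P) : Dual :=
  ∏ i, ((P i).pt (j i).succ - (P i).pt (j i).castSucc)

end sums

/-- The supremum of `g` on `S`. -/
def supOn {n : ℕ} (g : Space n → ℝ) (S : Set (Space n)) : ℝ := sSup (g '' S)

/-- The infimum of `g` on `S`. -/
def infOn {n : ℕ} (g : Space n → ℝ) (S : Set (Space n)) : ℝ := sInf (g '' S)

/-- The type `θ` upper sum. -/
def upperSum {n : ℕ} (f : Space n → Dual) {a b : Space n} :
    (θ : Kind) → RectPartition θ a b → Dual
  | .one, P => ∑ j : RectPartition.Index P,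
      mkDual (supOn (fun x => Re (f x)) (RectPartition.sub P j))
        (supOn (fun x => Ze (f x)) (RectPartition.sub P j)) * RectPartition.vol P j
  | .two, P => ∑ j : RectPartition.Index P,
      mkDual (supOn (fun x => Re (f x)) (RectPartition.sub P j))
        (infOn (fun x => Ze (f x)) (RectPartition.sub P j)) * RectPartition.vol P j

/-- The type `θ` lower sum. -/
def lowerSum {n : ℕ} (f : Space n → Dual) {a b : Space n} :
    (θ : Kind) → RectPartition θ a b → Dual
  | .one, P => ∑ j : RectPartition.Index P,
      mkDual (infOn (fun x => Re (f x)) (RectPartition.sub P j))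
        (infOn (fun x => Ze (f x)) (RectPartition.sub P j)) * RectPartition.vol P j
  | .two, P => ∑ j : RectPartition.Index P,
      mkDual (infOn (fun x => Re (f x)) (RectPartition.sub P j))
        (supOn (fun x => Ze (f x)) (RectPartition.sub P j)) * RectPartition.vol P j

/-- The type `θ` lower integral of `f` on the rectangle `∏ [a i, b i]_θ`. -/
def lowerIntegral {n : ℕ} (f : Space n → Dual) (a b : Space n) : Kind → Dual
  | .one => mkDual (⨆ P : RectPartition .one a b, Re (lowerSum f .one P))
      (⨆ P : RectPartition .one a b, Ze (lowerSum f .one P))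
  | .two => mkDual (⨆ P : RectPartition .two a b, Re (lowerSum f .two P))
      (⨅ P : RectPartition .two a b, Ze (lowerSum f .two P))

/-- The type `θ` upper integral of `f` on the rectangle `∏ [a i, b i]_θ`. -/
def upperIntegral {n : ℕ} (f : Space n → Dual) (a b : Space n) : Kind → Dual
  | .one => mkDual (⨅ P : RectPartition .one a b, Re (upperSum f .one P))
      (⨅ P : RectPartition .one a b, Ze (upperSum f .one P))
  | .two => mkDual (⨅ P : RectPartition .two a b, Re (upperSum f .two P))
      (⨆ P : RectPartition .two a b, Ze (upperSum f .two P))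

/-- `f` is bounded on `S`: its real part and its zero-divisor part are. -/
def DualBoundedOn {n : ℕ} (f : Space n → Dual) (S : Set (Space n)) : Prop :=
  ∃ m M : ℝ, ∀ x ∈ S, (m ≤ Re (f x) ∧ Re (f x) ≤ M) ∧ (m ≤ Ze (f x) ∧ Ze (f x) ≤ M)

/-- `f` is type `θ` integrable on `∏ [a i, b i]_θ`: it is bounded there, and its lower and upper
integrals are equal. -/
def TIntegrable (θ : Kind) {n : ℕ} (f : Space n → Dual) (a b : Space n) : Prop :=
  DualBoundedOn f (TRect θ a b) ∧ lowerIntegral f a b θ = upperIntegral f a b θ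

/-- The type `θ` integral (the common value of the lower and the upper integral when `f` is
type `θ` integrable). -/
def tIntegral (θ : Kind) {n : ℕ} (f : Space n → Dual) (a b : Space n) : Dual :=
  upperIntegral f a b θ

/-! ### Alternating tensors and differential forms -/

/-- Alternating dual real `k`-tensors on dual real `n`-space. -/
abbrev Alt (n k : ℕ) : Type := Space n [⋀^Fin k]→ₗ[Dual] Dual

/-- The tensor product `(S ⊗ T)(v₁, …, v_{k+l}) = S(v₁, …, v_k) T(v_{k+1}, …, v_{k+l})`. -/
def tensor {n k l : ℕ} (S : MultilinearMap Dual (fun _ : Fin k => Space n) Dual)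
    (T : MultilinearMap Dual (fun _ : Fin l => Space n) Dual) :
    MultilinearMap Dual (fun _ : Fin (k + l) => Space n) Dual :=
  ((LinearMap.mul' Dual Dual).compMultilinearMap (S.domCoprod T)).domDomCongr finSumFinEquiv

/-- `Alt(T)(v₁, …, v_k) = (1/k!) ∑_σ sgn(σ) T(v_{σ(1)}, …, v_{σ(k)})`. -/
def altOf {n k : ℕ} (T : MultilinearMap Dual (fun _ : Fin k => Space n) Dual) : Alt n k :=
  algebraMap ℝ Dual (1 / (k ! : ℝ)) • MultilinearMap.alternatization T

/-- The wedge product `w ∧ η = ((k+l)!/(k! l!)) Alt(w ⊗ η)`. -/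
def wedge {n k l : ℕ} (w : Alt n k) (η : Alt n l) : Alt n (k + l) :=
  algebraMap ℝ Dual (((k + l)! : ℝ) / ((k ! : ℝ) * (l ! : ℝ))) •
    altOf (tensor w.toMultilinearMap η.toMultilinearMap)

/-- A module map to the dual numbers as an alternating `1`-tensor. -/
def oneForm {n : ℕ} (u : Space n →ₗ[Dual] Dual) : Alt n 1 :=
  AlternatingMap.ofSubsingleton Dual (Space n) Dual (0 : Fin 1) u

/-- The wedge product of a `1`-tensor and a `k`-tensor, as a `(k+1)`-tensor. -/
def oneWedge {n k : ℕ} (u : Space n →ₗ[Dual] Dual) (η : Alt n k) : Alt n (k + 1) :=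
  (wedge (oneForm u) η).domDomCongr (finCongr (Nat.add_comm 1 k))

/-- `dx^{i₁} ∧ ⋯ ∧ dx^{i_k}` (the constant `1` when `k = 0`). -/
def dx {n : ℕ} : {k : ℕ} → (Fin k → Fin n) → Alt n k
  | 0, _ => AlternatingMap.constOfIsEmpty Dual (Space n) (Fin 0) (1 : Dual)
  | _ + 1, I => oneWedge (LinearMap.proj (I 0)) (dx fun j => I j.succ)

/-- A field of alternating `k`-tensors on dual real `n`-space. -/
abbrev Form (n k : ℕ) : Type := Space n → Alt n k

/-- `w` is a dual real differentiable `k`-form on `A`: there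
`w = ∑_{i₁ < ⋯ < i_k} w_{i₁ … i_k} dx^{i₁} ∧ ⋯ ∧ dx^{i_k}` with coefficients that are dual real
differentiable on `A`. -/
def IsDiffForm {n k : ℕ} (w : Form n k) (A : Set (Space n)) : Prop :=
  ∃ f : (Fin k ↪o Fin n) → Space n → Dual,
    (∀ I, DualDiffOn (toSpaceOne (f I)) A) ∧ ∀ p ∈ A, w p = ∑ I, f I p • dx I

/-- The coefficient `w_{i₁ … i_k}` of a form: its value on `(e_{i₁}, …, e_{i_k})`. -/
def coeff {n k : ℕ} (w : Form n k) (I : Fin k ↪o Fin n) : Space n → Dual :=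
  fun p => w p fun j => Pi.single (I j) 1

/-- The `1`-tensor `df (p)` of a dual-valued function `f`. -/
def differential {n : ℕ} (f : Space n → Dual) (p : Space n) : Space n →ₗ[Dual] Dual :=
  LinearMap.proj 0 ∘ₗ dualDeriv (toSpaceOne f) p

/-- The dual real differential
`dw = ∑_{i₁ < ⋯ < i_k} d(w_{i₁ … i_k}) ∧ dx^{i₁} ∧ ⋯ ∧ dx^{i_k}`. -/
def d {n k : ℕ} (w : Form n k) : Form n (k + 1) :=
  fun p => ∑ I : Fin k ↪o Fin n, oneWedge (differential (coeff w I) p) (dx I)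

/-- The pullback `g^* w`. -/
def pullback {n m k : ℕ} (g : Space m → Space n) (w : Form n k) : Form m k :=
  fun p => (w (g p)).compLinearMap (dualDeriv g p)

/-! ### Singular cubes and chains -/

/-- `b = 1 + (-1)^{θ-1} r 1^#`. -/
def bPt (θ : Kind) (r : ℝ≥0) : Dual := mkDual 1 (θ.sgn * r)

/-- `[0, b]_θ^k` (for `k = 0` the one-point space). -/
def cube (θ : Kind) (r : ℝ≥0) (k : ℕ) : Set (Space k) := TRect θ (fun _ => 0) (fun _ => bPt θ r)

/-- A type `θ` singular `k`-cube in `A`: a function `[0, b]_θ^k → A` that extends to an open set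
as a dual real differentiable function whose derivative is dual real differentiable.  (The latter
makes pullbacks of dual real differentiable forms dual real differentiable.) -/
structure SingularCube (θ : Kind) (r : ℝ≥0) (k : ℕ) {n : ℕ} (A : Set (Space n)) where
  toFun : cube θ r k → Space n
  mem : ∀ x, toFun x ∈ A
  exists_ext : ∃ g : Space k → Space n, (∀ x : cube θ r k, g x = toFun x) ∧
    ∃ U : Set (Space k), IsOpen U ∧ cube θ r k ⊆ U ∧ TwiceDualDiffOn g U

/-- An extension of a singular cube to an open set.  At the points of `[0, b]_θ^k`, its values and
its dual real derivative are determined by the cube. -/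
def SingularCube.ext {θ : Kind} {r : ℝ≥0} {k n : ℕ} {A : Set (Space n)}
    (c : SingularCube θ r k A) : Space k → Space n := c.exists_ext.choose

/-- Type `θ` `k`-chains in `A`: formal finite sums of singular cubes with integer coefficients. -/
abbrev Chain (θ : Kind) (r : ℝ≥0) (k : ℕ) {n : ℕ} (A : Set (Space n)) : Type :=
  SingularCube θ r k A →₀ ℤ

/-- The `j`-th coordinate of a face: `α b` with `α ∈ {0, 1}`. -/
def facePt (θ : Kind) (r : ℝ≥0) (α : Fin 2) : Dual := (α.val : Dual) * bPt θ r

/-- The face map `I_{(j, α)} (x) = (x¹, …, x^{j-1}, α b, x^j, …, x^k)`. -/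
def faceMap (θ : Kind) (r : ℝ≥0) {k : ℕ} (j : Fin (k + 1)) (α : Fin 2) (x : Space k) :
    Space (k + 1) :=
  j.insertNth (α := fun _ => Dual) (facePt θ r α) x

theorem facePt_mem (θ : Kind) (r : ℝ≥0) (α : Fin 2) : facePt θ r α ∈ TIcc θ 0 (bPt θ r) := by
  have h : TLt θ 0 (bPt θ r) := by
    cases θ <;> left <;> simp [bPt, mkDual, Re, Ze, Kind.sgn]
  fin_cases α
  · simpa [facePt, TIcc, TLe] using Or.inl h
  · simpa [facePt, TIcc, TLe] using Or.inl h

theorem faceMap_mem (θ : Kind) (r : ℝ≥0) {k : ℕ} (j : Fin (k + 1)) (α : Fin 2) {x : Space k}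
    (hx : x ∈ cube θ r k) : faceMap θ r j α x ∈ cube θ r (k + 1) := by
  intro i
  refine Fin.succAboveCases j ?_ (fun l => ?_) i
  · simpa [faceMap] using facePt_mem θ r α
  · simpa [faceMap] using hx l

/-- The linear part of a face map. -/
def faceLin {k : ℕ} (j : Fin (k + 1)) : Space k →ₗ[Dual] Space (k + 1) where
  toFun x := j.insertNth (α := fun _ => Dual) 0 x
  map_add' x y := by
    funext i
    refine Fin.succAboveCases j ?_ (fun l => ?_) i <;> simp
  map_smul' a x := by
    funext i
    refine Fin.succAboveCases j ?_ (fun l => ?_) i <;> simp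

theorem faceMap_sub (θ : Kind) (r : ℝ≥0) {k : ℕ} (j : Fin (k + 1)) (α : Fin 2) (x y : Space k) :
    faceMap θ r j α x - faceMap θ r j α y = faceLin j (x - y) := by
  funext i
  refine Fin.succAboveCases j ?_ (fun l => ?_) i <;> simp [faceMap, faceLin]

theorem dnorm_faceLin {k : ℕ} (j : Fin (k + 1)) (x : Space k) : dnorm (faceLin j x) = dnorm x := by
  simp [dnorm, faceLin, Fin.sum_univ_succAbove _ j, Re, Ze]

theorem continuous_faceMap (θ : Kind) (r : ℝ≥0) {k : ℕ} (j : Fin (k + 1)) (α : Fin 2) :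
    Continuous (faceMap θ r j α) := by
  refine continuous_pi fun i => ?_
  refine Fin.succAboveCases j ?_ (fun l => ?_) i
  · simpa [faceMap] using continuous_const
  · simpa [faceMap] using continuous_apply l

theorem faceMap_injective (θ : Kind) (r : ℝ≥0) {k : ℕ} (j : Fin (k + 1)) (α : Fin 2) :
    Function.Injective (faceMap θ r j α) := by
  intro x y h
  funext l
  simpa [faceMap] using congrFun h (j.succAbove l)

theorem HasDualDeriv.comp_faceMap {k n : ℕ} {g : Space (k + 1) → Space n}
    {L : Space (k + 1) →ₗ[Dual] Space n} {θ : Kind} {r : ℝ≥0} {j : Fin (k + 1)} {α : Fin 2}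
    {a : Space k} (h : HasDualDeriv g L (faceMap θ r j α a)) :
    HasDualDeriv (fun x => g (faceMap θ r j α x)) (L ∘ₗ faceLin j) a := by
  have ht : Tendsto (faceMap θ r j α) (𝓝[≠] a) (𝓝[≠] (faceMap θ r j α a)) :=
    tendsto_nhdsWithin_of_tendsto_nhds_of_eventually_within _
      ((continuous_faceMap θ r j α).continuousAt.mono_left nhdsWithin_le_nhds)
      (eventually_nhdsWithin_of_forall fun x hx hxa => hx (faceMap_injective θ r j α hxa))
  refine (h.comp ht).congr fun x => ?_
  simp only [Function.comp_apply, faceMap_sub, dnorm_faceLin, LinearMap.comp_apply]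

theorem TwiceDualDiffOn.comp_faceMap {k n : ℕ} {g : Space (k + 1) → Space n}
    {U : Set (Space (k + 1))} (h : TwiceDualDiffOn g U) (θ : Kind) (r : ℝ≥0) (j : Fin (k + 1))
    (α : Fin 2) :
    TwiceDualDiffOn (fun x => g (faceMap θ r j α x)) (faceMap θ r j α ⁻¹' U) := by
  obtain ⟨L, hL, hL'⟩ := h
  refine ⟨fun a => L (faceMap θ r j α a) ∘ₗ faceLin j, fun a ha => (hL _ ha).comp_faceMap,
    fun v a ha => ?_⟩
  obtain ⟨M, hM⟩ := hL' (faceLin j v) _ ha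
  exact ⟨_, hM.comp_faceMap⟩

/-- The `(j, α)`-face `c ∘ I_{(j, α)}` of a singular cube. -/
def SingularCube.face {θ : Kind} {r : ℝ≥0} {k n : ℕ} {A : Set (Space n)}
    (c : SingularCube θ r (k + 1) A) (j : Fin (k + 1)) (α : Fin 2) : SingularCube θ r k A where
  toFun x := c.toFun ⟨faceMap θ r j α x, faceMap_mem θ r j α x.2⟩
  mem _ := c.mem _
  exists_ext := by
    obtain ⟨g, hg, U, hU, hcU, hgU⟩ := c.exists_ext
    exact ⟨fun x => g (faceMap θ r j α x), fun x => hg ⟨_, faceMap_mem θ r j α x.2⟩,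
      faceMap θ r j α ⁻¹' U, hU.preimage (continuous_faceMap θ r j α),
      fun x hx => hcU (faceMap_mem θ r j α hx), hgU.comp_faceMap θ r j α⟩

/-- The boundary `∑_j ∑_α (-1)^{j+α} c_{(j, α)}` of a singular cube (with `j` counted from `1`). -/
def SingularCube.boundary {θ : Kind} {r : ℝ≥0} {k n : ℕ} {A : Set (Space n)}
    (c : SingularCube θ r (k + 1) A) : Chain θ r k A :=
  ∑ j : Fin (k + 1), ∑ α : Fin 2, Finsupp.single (c.face j α) ((-1) ^ (j.val + 1 + α.val))

/-- The boundary of a chain. -/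
def Chain.boundary {θ : Kind} {r : ℝ≥0} {k n : ℕ} {A : Set (Space n)}
    (c : Chain θ r (k + 1) A) : Chain θ r k A :=
  Finsupp.sum c fun s a => a • s.boundary

/-! ### Integration of forms over chains -/

/-- The function `f` with `w = f dx¹ ∧ ⋯ ∧ dx^k`, for a `k`-form on dual real `k`-space. -/
def topCoeff {k : ℕ} (w : Form k k) : Space k → Dual := coeff w (RelEmbedding.refl _)

/-- The integral of the `k`-form `w` over the singular `k`-cube `c` is defined: the
function `f` with `c^* w = f dx¹ ∧ ⋯ ∧ dx^k` is type `θ` integrable on `[0, b]_θ^k`.  There is no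
condition if `k = 0`. -/
def CubeIntegrable {θ : Kind} {r : ℝ≥0} {n : ℕ} {A : Set (Space n)} :
    {k : ℕ} → Form n k → SingularCube θ r k A → Prop
  | 0, _, _ => True
  | _ + 1, w, c => TIntegrable θ (topCoeff (pullback c.ext w)) (fun _ => 0) (fun _ => bPt θ r)

/-- The integral of a `k`-form over a singular `k`-cube; for `k = 0` it is the value of the
form at the point that is the cube. -/
def cubeIntegral {θ : Kind} {r : ℝ≥0} {n : ℕ} {A : Set (Space n)} :
    {k : ℕ} → Form n k → SingularCube θ r k A → Dual
  | 0, w, c => w (c.toFun ⟨0, fun i => i.elim0⟩) Fin.elim0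
  | _ + 1, w, c => tIntegral θ (topCoeff (pullback c.ext w)) (fun _ => 0) (fun _ => bPt θ r)

/-- The integral of a `k`-form over each of the cubes of a `k`-chain is defined. -/
def ChainIntegrable {θ : Kind} {r : ℝ≥0} {n k : ℕ} {A : Set (Space n)} (w : Form n k)
    (c : Chain θ r k A) : Prop :=
  ∀ s ∈ c.support, CubeIntegrable w s

/-- The integral of a `k`-form over a `k`-chain `∑ aᵢ cᵢ`, which is `∑ aᵢ ∫_{cᵢ} w`. -/
def chainIntegral {θ : Kind} {r : ℝ≥0} {n k : ℕ} {A : Set (Space n)} (w : Form n k)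
    (c : Chain θ r k A) : Dual :=
  Finsupp.sum c fun s a => a • cubeIntegral w s

end DualStokes

end

noncomputable section

namespace DualStokes

open MeasureTheory Set
open scoped Interval

/-! ### The dual numbers as a real normed algebra -/

/-! A dual real differentiable function is real differentiable with a derivative that is linear over
the dual numbers. In one variable the derivative of `F` is then multiplication by a dual number, so
commutativity makes `F dz` a closed form, and its integral along a path in an interval depends only
on the endpoints (`segment_integral_add`).

This singles out the value of the type `θ` integral: the iterated line integral along the segments
from `a i` to `b i`, that is, the volume times the mean over a real `k`-dimensional diagonal plane
(`boxInt`). By path independence it is additive when an edge is cut at any intermediate point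
(`boxInt_update_add`), hence over every partition (`sum_boxInt`), although the subrectangles in
general neither cover the box nor have their diagonals on its diagonal plane.

Each order is compatible with sums and with products of nonnegative elements, and subrectangles have
nonnegative volume. So every lower sum is at most `boxInt` and every upper sum is at least `boxInt`.
Uniform continuity closes the gap along uniform partitions, which gives integrability and the value
at once (`tIntegral_cube`).

Stokes' theorem thereby becomes the real divergence theorem on the unit cube, transported by `t ↦ t
b`. Dual linearity turns each real partial derivative into `b` times the dual one, and this `b` is
the ratio of the volumes `b ^ (k + 1)` of the cube and `b ^ k` of its faces (`boxInt_divergence`).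
The divergence is the coefficient of the pullback of `dw`, because the second derivatives of the
cube cancel by symmetry (`sum_fderiv_pullback`). Finally, the extension chosen for a face has the
right derivative on the cube, since values on the cube determine it
(`HasDualDeriv.unique_of_eqOn_cube`). -/

theorem dual_ext {x y : Dual} (h₁ : Re x = Re y) (h₂ : Ze x = Ze y) : x = y :=
  TrivSqZeroExt.ext h₁ h₂

@[simp] theorem Re_zero : Re 0 = 0 := rfl
@[simp] theorem Ze_zero : Ze 0 = 0 := rfl
@[simp] theorem Re_one : Re 1 = 1 := rfl
@[simp] theorem Ze_one : Ze 1 = 0 := rfl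
@[simp] theorem Re_add (x y : Dual) : Re (x + y) = Re x + Re y := rfl
@[simp] theorem Ze_add (x y : Dual) : Ze (x + y) = Ze x + Ze y := rfl
@[simp] theorem Re_neg (x : Dual) : Re (-x) = -Re x := rfl
@[simp] theorem Re_sub (x y : Dual) : Re (x - y) = Re x - Re y := rfl
@[simp] theorem Ze_sub (x y : Dual) : Ze (x - y) = Ze x - Ze y := rfl
@[simp] theorem Re_smul (t : ℝ) (x : Dual) : Re (t • x) = t * Re x := rfl
@[simp] theorem Ze_smul (t : ℝ) (x : Dual) : Ze (t • x) = t * Ze x := rfl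
@[simp] theorem Re_mul (x y : Dual) : Re (x * y) = Re x * Re y := rfl
@[simp] theorem Ze_mul (x y : Dual) : Ze (x * y) = Re x * Ze y + Re y * Ze x := by
  simp [Re, Ze, TrivSqZeroExt.snd_mul, mul_comm]
@[simp] theorem Re_mkDual (a c : ℝ) : Re (mkDual a c) = a := by simp [Re, mkDual]
@[simp] theorem Ze_mkDual (a c : ℝ) : Ze (mkDual a c) = c := by simp [Ze, mkDual]

theorem dual_norm (x : Dual) : ‖x‖ = |Re x| + |Ze x| := TrivSqZeroExt.norm_def x

instance : FiniteDimensional ℝ Dual := inferInstanceAs (FiniteDimensional ℝ (ℝ × ℝ))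

instance (n : ℕ) : FiniteDimensional ℝ (Space n) :=
  inferInstanceAs (FiniteDimensional ℝ (Fin n → Dual))

/-- The real part as a continuous linear map. -/
def reL : Dual →L[ℝ] ℝ :=
  LinearMap.toContinuousLinearMap { toFun := Re, map_add' := Re_add, map_smul' := Re_smul }

/-- The zero-divisor part as a continuous linear map. -/
def zeL : Dual →L[ℝ] ℝ :=
  LinearMap.toContinuousLinearMap { toFun := Ze, map_add' := Ze_add, map_smul' := Ze_smul }


theorem continuous_Re : Continuous Re := reL.continuous
theorem continuous_Ze : Continuous Ze := zeL.continuous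

/-! ### The orders -/

theorem Kind.sgn_mul_self (θ : Kind) : θ.sgn * θ.sgn = 1 := by cases θ <;> simp [Kind.sgn]

/-- Twisting the zero-divisor part by the sign makes both orders the product order on the plane, so
that almost everything below is proved for both values of `θ` at once. -/
theorem TLe_iff {θ : Kind} {x y : Dual} :
    TLe θ x y ↔ Re x ≤ Re y ∧ θ.sgn * Ze x ≤ θ.sgn * Ze y := by
  cases θ
  all_goals
    simp only [TLe, TLt, Kind.sgn, one_mul, neg_mul, neg_le_neg_iff]
    constructor
    · rintro ((h | h) | rfl)
      · exact ⟨h.1.le, h.2⟩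
      · exact ⟨h.1.le, h.2.le⟩
      · exact ⟨le_rfl, le_rfl⟩
    · rintro ⟨h₁, h₂⟩
      rcases h₁.lt_or_eq with h | h
      · exact Or.inl (Or.inl ⟨h, h₂⟩)
      · rcases h₂.lt_or_eq with h' | h'
        · exact Or.inl (Or.inr ⟨h, h'⟩)
        · exact Or.inr (dual_ext h (by simpa using h'.symm ▸ rfl))

theorem TLe.refl (θ : Kind) (x : Dual) : TLe θ x x := Or.inr rfl

theorem TLe.trans {θ : Kind} {x y z : Dual} (h : TLe θ x y) (h' : TLe θ y z) : TLe θ x z := by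
  rw [TLe_iff] at *; exact ⟨h.1.trans h'.1, h.2.trans h'.2⟩

theorem TLe_sub_nonneg {θ : Kind} {x y : Dual} : TLe θ 0 (y - x) ↔ TLe θ x y := by
  simp only [TLe_iff, Re_zero, Ze_zero, Re_sub, Ze_sub, mul_zero, mul_sub, sub_nonneg]

theorem TLe.add {θ : Kind} {x y x' y' : Dual} (h : TLe θ x y) (h' : TLe θ x' y') :
    TLe θ (x + x') (y + y') := by
  simp only [TLe_iff, Re_add, Ze_add, mul_add] at *
  exact ⟨add_le_add h.1 h'.1, add_le_add h.2 h'.2⟩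

/-- The zero-divisor part of a product has no `Ze x * Ze y` term. Each of its terms contains exactly
one zero-divisor part, so the sign twist passes through even when `θ` is two. -/
theorem TLe.mul_nonneg {θ : Kind} {x y : Dual} (h : TLe θ 0 x) (h' : TLe θ 0 y) :
    TLe θ 0 (x * y) := by
  simp only [TLe_iff, Re_zero, Ze_zero, mul_zero, Re_mul, Ze_mul] at *
  refine ⟨_root_.mul_nonneg h.1 h'.1, ?_⟩
  have := _root_.mul_nonneg h.1 h'.2
  have := _root_.mul_nonneg h'.1 h.2
  linarith

theorem TLe.mul_right {θ : Kind} {x y z : Dual} (h : TLe θ x y) (hz : TLe θ 0 z) :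
    TLe θ (x * z) (y * z) := by
  rw [← TLe_sub_nonneg, ← sub_mul]
  exact (TLe_sub_nonneg.2 h).mul_nonneg hz

theorem TLe.smul {θ : Kind} {x y : Dual} (h : TLe θ x y) {t : ℝ} (ht : 0 ≤ t) :
    TLe θ (t • x) (t • y) := by
  simp only [TLe_iff, Re_smul, Ze_smul, mul_left_comm _ t] at *
  exact ⟨mul_le_mul_of_nonneg_left h.1 ht, mul_le_mul_of_nonneg_left h.2 ht⟩

theorem TLe.sum {ι : Type*} {θ : Kind} (s : Finset ι) {x y : ι → Dual}
    (h : ∀ i ∈ s, TLe θ (x i) (y i)) : TLe θ (∑ i ∈ s, x i) (∑ i ∈ s, y i) := by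
  classical
  induction s using Finset.induction_on with
  | empty => exact TLe.refl _ _
  | insert i s hi ih =>
    rw [Finset.sum_insert hi, Finset.sum_insert hi]
    exact (h i (Finset.mem_insert_self _ _)).add
      (ih fun j hj => h j (Finset.mem_insert_of_mem hj))

theorem TLe_zero_one (θ : Kind) : TLe θ 0 1 := by simp [TLe_iff]

theorem TLe.prod_nonneg {ι : Type*} {θ : Kind} (s : Finset ι) {x : ι → Dual}
    (h : ∀ i ∈ s, TLe θ 0 (x i)) : TLe θ 0 (∏ i ∈ s, x i) := by
  classical
  induction s using Finset.induction_on with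
  | empty => exact TLe_zero_one θ
  | insert i s hi ih =>
    rw [Finset.prod_insert hi]
    exact (h i (Finset.mem_insert_self _ _)).mul_nonneg
      (ih fun j hj => h j (Finset.mem_insert_of_mem hj))

theorem TLe_antisymm {θ : Kind} {x y : Dual} (h : TLe θ x y) (h' : TLe θ y x) : x = y := by
  rw [TLe_iff] at *
  have h2 := congrArg (θ.sgn * ·) (le_antisymm h.2 h'.2)
  simp only [← mul_assoc, Kind.sgn_mul_self, one_mul] at h2
  exact dual_ext (le_antisymm h.1 h'.1) h2

theorem segment_mem_TIcc {θ : Kind} {a b : Dual} (h : TLe θ a b) {t : ℝ} (h0 : 0 ≤ t)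
    (h1 : t ≤ 1) : a + t • (b - a) ∈ TIcc θ a b := by
  have h' := TLe_sub_nonneg.2 h
  constructor
  · simpa using (TLe.refl θ a).add (h'.smul h0)
  · rw [← TLe_sub_nonneg]
    have : b - (a + t • (b - a)) = (1 - t) • (b - a) := by rw [sub_smul, one_smul]; abel
    rw [this]
    simpa using h'.smul (sub_nonneg.2 h1)

theorem isClosed_TIcc (θ : Kind) (a b : Dual) : IsClosed (TIcc θ a b) := by
  simp only [TIcc, TLe_iff, Set.ofPred_and]
  have hr := continuous_Re
  have hz : Continuous fun x => θ.sgn * Ze x := continuous_const.mul continuous_Ze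
  exact ((isClosed_le continuous_const hr).inter (isClosed_le continuous_const hz)).inter
    ((isClosed_le hr continuous_const).inter (isClosed_le hz continuous_const))

theorem isCompact_TIcc (θ : Kind) (a b : Dual) : IsCompact (TIcc θ a b) := by
  refine Metric.isCompact_of_isClosed_isBounded (isClosed_TIcc θ a b) ?_
  refine (Metric.isBounded_closedBall (x := (0 : Dual))
    (r := (|Re a| + |Re b|) + (|Ze a| + |Ze b|))).subset fun x hx => ?_
  obtain ⟨h₁, h₂⟩ := hx
  rw [TLe_iff] at h₁ h₂
  rw [mem_closedBall_zero_iff, dual_norm]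
  have key : ∀ p q s : ℝ, p ≤ s → s ≤ q → |s| ≤ |p| + |q| := fun p q s h h' => by
    have := neg_abs_le p; have := le_abs_self q
    have := abs_nonneg p; have := abs_nonneg q
    exact abs_le.2 ⟨by linarith, by linarith⟩
  have hs : ∀ p : ℝ, |θ.sgn * p| = |p| := fun p => by cases θ <;> simp [Kind.sgn]
  have := key _ _ _ h₁.2 h₂.2
  rw [hs, hs, hs] at this
  exact add_le_add (key _ _ _ h₁.1 h₂.1) this

theorem TRect_eq_pi {θ : Kind} {n : ℕ} (a b : Space n) :
    TRect θ a b = Set.pi Set.univ fun i => TIcc θ (a i) (b i) := by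
  ext x; simp [TRect]

theorem isCompact_TRect (θ : Kind) {n : ℕ} (a b : Space n) : IsCompact (TRect θ a b) := by
  rw [TRect_eq_pi]; exact isCompact_univ_pi fun i => isCompact_TIcc θ _ _

/-! ### Dual differentiability as real differentiability with dual-linear derivative -/

/-- `f` is real differentiable at `a` with a derivative that is linear over the dual numbers. -/
def DD {n : ℕ} {E : Type*} [NormedAddCommGroup E] [NormedSpace ℝ E] [Module Dual E]
    (f : Space n → E) (a : Space n) : Prop :=
  DifferentiableAt ℝ f a ∧ ∀ (z : Dual) v, fderiv ℝ f a (z • v) = z • fderiv ℝ f a v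

/-- A dual-linear map as a real continuous linear map. -/
def toRealCLM {n m : ℕ} (L : Space n →ₗ[Dual] Space m) : Space n →L[ℝ] Space m :=
  LinearMap.toContinuousLinearMap (L.restrictScalars ℝ)

@[simp] theorem toRealCLM_apply {n m : ℕ} (L : Space n →ₗ[Dual] Space m) (v : Space n) :
    toRealCLM L v = L v := rfl

/-- Each coordinate contributes `2 Re² + Ze² ≤ 3 ‖x‖²`. Together with `norm_le_dnorm` this compares
`dnorm` with the sup norm and turns dual derivatives into Fréchet derivatives. -/
theorem dnorm_le {n : ℕ} (x : Space n) : dnorm x ≤ Real.sqrt (3 * n) * ‖x‖ := by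
  have h : dnorm x ≤ Real.sqrt (3 * n * ‖x‖ ^ 2) := by
    apply Real.sqrt_le_sqrt
    have hb : ∀ i, |Re (x i)| ≤ ‖x‖ ∧ |Ze (x i)| ≤ ‖x‖ := fun i => by
      have := norm_le_pi_norm x i
      rw [dual_norm] at this
      exact ⟨by linarith [abs_nonneg (Ze (x i))], by linarith [abs_nonneg (Re (x i))]⟩
    have h1 : ∑ i, Re (x i) ^ 2 ≤ n * ‖x‖ ^ 2 := by
      refine (Finset.sum_le_sum fun i _ => sq_le_sq' (abs_le.1 (hb i).1).1
        (abs_le.1 (hb i).1).2).trans ?_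
      simp
    have h2 : ∑ i, Ze (x i) ^ 2 ≤ n * ‖x‖ ^ 2 := by
      refine (Finset.sum_le_sum fun i _ => sq_le_sq' (abs_le.1 (hb i).2).1
        (abs_le.1 (hb i).2).2).trans ?_
      simp
    linarith
  rwa [Real.sqrt_mul (by positivity), Real.sqrt_sq (norm_nonneg x)] at h

theorem norm_le_dnorm {n : ℕ} (x : Space n) : ‖x‖ ≤ 2 * dnorm x := by
  refine (pi_norm_le_iff_of_nonneg (by unfold dnorm; positivity)).2 fun i => ?_
  rw [dual_norm]
  have h1 : |Re (x i)| ≤ dnorm x := by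
    refine Real.abs_le_sqrt ?_
    have := Finset.single_le_sum (f := fun i => Re (x i) ^ 2) (fun i _ => sq_nonneg _)
      (Finset.mem_univ i)
    have h' : 0 ≤ ∑ i, Ze (x i) ^ 2 := Finset.sum_nonneg fun i _ => sq_nonneg _
    have h'' : 0 ≤ Re (x i) ^ 2 := sq_nonneg _
    linarith
  have h2 : |Ze (x i)| ≤ dnorm x := by
    refine Real.abs_le_sqrt ?_
    have := Finset.single_le_sum (f := fun i => Ze (x i) ^ 2) (fun i _ => sq_nonneg _)
      (Finset.mem_univ i)
    have h' : 0 ≤ ∑ i, Re (x i) ^ 2 := Finset.sum_nonneg fun i _ => sq_nonneg _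
    linarith
  linarith

theorem HasDualDeriv.hasFDerivAt {n m : ℕ} {f : Space n → Space m} {L : Space n →ₗ[Dual] Space m}
    {a : Space n} (h : HasDualDeriv f L a) : HasFDerivAt f (toRealCLM L) a := by
  rw [hasFDerivAt_iff_isLittleO, Asymptotics.isLittleO_iff]
  intro c hc
  -- The product of the constants in the two norm comparisons; the `+ 1` keeps it positive when `n =
  -- 0`.
  set C := 2 * (Real.sqrt (3 * n) + 1) with hC
  have hCpos : 0 < C := by positivity
  have hev : ∀ᶠ x in 𝓝[≠] a, dnorm (f x - f a - L (x - a)) / dnorm (x - a) < c / C :=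
    h.eventually_lt_const (by positivity)
  rw [eventually_nhdsWithin_iff] at hev
  filter_upwards [hev] with x hx
  rcases eq_or_ne x a with rfl | hne
  · simp
  have hpos : 0 < dnorm (x - a) := by
    have := norm_le_dnorm (x - a)
    have h' := norm_pos_iff.2 (sub_ne_zero.2 hne)
    linarith
  have h1 := (div_lt_iff₀ hpos).1 (hx hne)
  calc ‖f x - f a - toRealCLM L (x - a)‖ ≤ 2 * dnorm (f x - f a - L (x - a)) := norm_le_dnorm _
    _ ≤ 2 * (c / C * dnorm (x - a)) := by linarith
    _ ≤ 2 * (c / C * ((Real.sqrt (3 * n) + 1) * ‖x - a‖)) := by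
        have := dnorm_le (x - a)
        have : dnorm (x - a) ≤ (Real.sqrt (3 * n) + 1) * ‖x - a‖ := by
          nlinarith [norm_nonneg (x - a)]
        gcongr
    _ = c * ‖x - a‖ := by rw [hC]; field_simp

theorem HasDualDeriv.unique {n m : ℕ} {f : Space n → Space m} {L L' : Space n →ₗ[Dual] Space m}
    {a : Space n} (h : HasDualDeriv f L a) (h' : HasDualDeriv f L' a) : L = L' := by
  refine LinearMap.ext fun v => ?_
  exact congrArg (fun T : Space n →L[ℝ] Space m => T v) (h.hasFDerivAt.unique h'.hasFDerivAt)

theorem HasDualDeriv.dualDeriv_eq {n m : ℕ} {f : Space n → Space m}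
    {L : Space n →ₗ[Dual] Space m} {a : Space n} (h : HasDualDeriv f L a) : dualDeriv f a = L := by
  have hex : ∃ L : Space n →ₗ[Dual] Space m, HasDualDeriv f L a := ⟨L, h⟩
  rw [dualDeriv, dif_pos hex]
  exact hex.choose_spec.unique h

section DD

variable {n : ℕ} {E : Type*} [NormedAddCommGroup E] [NormedSpace ℝ E] [Module Dual E]

theorem HasDualDeriv.dd {m : ℕ} {f : Space n → Space m} {L : Space n →ₗ[Dual] Space m}
    {a : Space n} (h : HasDualDeriv f L a) : DD f a :=
  ⟨h.hasFDerivAt.differentiableAt, fun z v => by simp [h.hasFDerivAt.fderiv]⟩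

theorem DD.congr {f g : Space n → E} {a : Space n} (h : DD f a) (hfg : g =ᶠ[𝓝 a] f) : DD g a :=
  ⟨h.1.congr_of_eventuallyEq hfg, by rw [hfg.fderiv_eq]; exact h.2⟩

theorem DD.comp {m : ℕ} {f : Space m → E} {g : Space n → Space m} {a : Space n}
    (hf : DD f (g a)) (hg : DD g a) : DD (fun x => f (g x)) a := by
  refine ⟨hf.1.comp a hg.1, fun z v => ?_⟩
  have := fderiv_comp (f := g) a hf.1 hg.1
  simp only [Function.comp_def] at this
  simp [this, hg.2, hf.2]

theorem DD.apply {m : ℕ} {f : Space n → Space m} {a : Space n} (h : DD f a) (i : Fin m) :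
    DD (fun x => f x i) a := by
  have : HasFDerivAt (fun x => f x i) ((ContinuousLinearMap.proj i).comp (fderiv ℝ f a)) a :=
    (hasFDerivAt_pi'.1 h.1.hasFDerivAt) i
  refine ⟨this.differentiableAt, fun z v => ?_⟩
  simp [this.fderiv, h.2]

theorem DD.const (c : E) (a : Space n) : DD (fun _ => c) a :=
  ⟨differentiableAt_const _, by simp⟩

theorem DD.add {f g : Space n → E} {a : Space n} (hf : DD f a) (hg : DD g a) :
    DD (fun x => f x + g x) a :=
  ⟨hf.1.add hg.1, fun z v => by simp [fderiv_fun_add hf.1 hg.1, hf.2, hg.2]⟩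

theorem DD.sum {ι : Type*} (s : Finset ι) {f : ι → Space n → E} {a : Space n}
    (h : ∀ i ∈ s, DD (f i) a) : DD (fun x => ∑ i ∈ s, f i x) a := by
  classical
  induction s using Finset.induction_on with
  | empty => simpa using DD.const (0 : E) a
  | insert i s hi ih =>
    simp only [Finset.sum_insert hi]
    exact (h i (Finset.mem_insert_self _ _)).add
      (ih fun j hj => h j (Finset.mem_insert_of_mem hj))

theorem DD.mul {f g : Space n → Dual} {a : Space n} (hf : DD f a) (hg : DD g a) :
    DD (fun x => f x * g x) a := by
  refine ⟨hf.1.mul hg.1, fun z v => ?_⟩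
  simp only [fderiv_fun_mul hf.1 hg.1, add_apply,
    smul_apply, hf.2, hg.2, smul_eq_mul]
  ring

theorem DD.hasFDerivAt {f : Space n → E} {a : Space n} (h : DD f a) :
    HasFDerivAt f (fderiv ℝ f a) a := h.1.hasFDerivAt

end DD

theorem DualDiffOn.dd {n : ℕ} {f : Space n → Dual} {U : Set (Space n)}
    (h : DualDiffOn (toSpaceOne f) U) {a : Space n} (ha : a ∈ U) : DD f a := by
  obtain ⟨L, hL⟩ := h a ha
  exact hL.dd.apply 0

/-! ### Path independence of line integrals of dual differentiable functions -/

/-- The integral of the closed form `F dz` around the triangle `a`, `b`, `c` vanishes. The triangle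
is parametrized by the unit square through `H (s, t) = a + s (b + t (c - b) - a)`, which stays in
the interval from `a` to `c`, and the divergence theorem is applied on the square. -/
theorem segment_integral_add {θ : Kind} {a b c : Dual} (hab : TLe θ a b) (hbc : TLe θ b c)
    {F F' : Dual → Dual}
    (hF : ∀ z ∈ TIcc θ a c, HasFDerivAt F (ContinuousLinearMap.mul ℝ Dual (F' z)) z) :
    (b - a) * (∫ s in (0 : ℝ)..1, F (a + s • (b - a))) +
      (c - b) * (∫ s in (0 : ℝ)..1, F (b + s • (c - b))) =
      (c - a) * ∫ s in (0 : ℝ)..1, F (a + s • (c - a)) := by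
  set p : ℝ × ℝ → Dual := fun x => b + x.2 • (c - b) - a with hp
  set H : ℝ × ℝ → Dual := fun x => a + x.1 • p x with hH
  have hmem : ∀ x ∈ [[(0 : ℝ), 1]] ×ˢ [[(0 : ℝ), 1]], H x ∈ TIcc θ a c := by
    rintro ⟨s, t⟩ ⟨hs, ht⟩
    rw [uIcc_of_le zero_le_one] at hs ht
    have h1 := segment_mem_TIcc hbc ht.1 ht.2
    have h2 := segment_mem_TIcc (hab.trans h1.1) hs.1 hs.2
    exact ⟨h2.1, h2.2.trans h1.2⟩
  set p' : ℝ × ℝ →L[ℝ] Dual := (ContinuousLinearMap.snd ℝ ℝ ℝ).smulRight (c - b) with hp'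
  have hpd : ∀ x, HasFDerivAt p p' x := fun x =>
    ((hasFDerivAt_snd.smul_const (c - b)).const_add b).sub_const a
  set H' : ℝ × ℝ → ℝ × ℝ →L[ℝ] Dual := fun x =>
    x.1 • p' + (ContinuousLinearMap.fst ℝ ℝ ℝ).smulRight (p x) with hH'
  have hHd : ∀ x, HasFDerivAt H (H' x) x := fun x =>
    (hasFDerivAt_fst.smul (hpd x)).const_add a
  set q' : ℝ × ℝ →L[ℝ] Dual := (ContinuousLinearMap.fst ℝ ℝ ℝ).smulRight (c - b) with hq'
  have hqd : ∀ x, HasFDerivAt (fun x : ℝ × ℝ => x.1 • (c - b)) q' x := fun x =>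
    hasFDerivAt_fst.smul_const (c - b)
  set K' : ℝ × ℝ → ℝ × ℝ →L[ℝ] Dual := fun x =>
    (ContinuousLinearMap.mul ℝ Dual (F' (H x))).comp (H' x) with hK'
  have hKd : ∀ x ∈ [[(0 : ℝ), 1]] ×ˢ [[(0 : ℝ), 1]],
      HasFDerivAt (fun x => F (H x)) (K' x) x := fun x hx =>
    (hF _ (hmem x hx)).comp x (hHd x)
  have hfd : ∀ x ∈ [[(0 : ℝ), 1]] ×ˢ [[(0 : ℝ), 1]],
      HasFDerivAt (fun x : ℝ × ℝ => F (H x) * (x.1 • (c - b)))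
        (F (H x) • q' + (x.1 • (c - b)) • K' x) x := fun x hx =>
    (hKd x hx).mul (hqd x)
  have hgd : ∀ x ∈ [[(0 : ℝ), 1]] ×ˢ [[(0 : ℝ), 1]],
      HasFDerivAt (fun x : ℝ × ℝ => -(F (H x) * p x))
        (-(F (H x) • p' + p x • K' x)) x := fun x hx =>
    ((hKd x hx).mul (hpd x)).neg
  have hsub : ∀ x ∈ Ioo (min (0 : ℝ) 1) (max 0 1) ×ˢ Ioo (min (0 : ℝ) 1) (max 0 1),
      x ∈ [[(0 : ℝ), 1]] ×ˢ [[(0 : ℝ), 1]] := fun x hx =>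
    ⟨Ioo_subset_Icc_self hx.1, Ioo_subset_Icc_self hx.2⟩
  -- The two fields are `F(H) ∂ₜH` and `-F(H) ∂ₛH`. Their divergence vanishes because mixed partials
  -- of `H` agree and `∂ₛH ∂ₜH = ∂ₜH ∂ₛH`. As it is identically zero, its integrability needs no
  -- continuity of `F'`.
  have hzero : ∀ x : ℝ × ℝ, (F (H x) • q' + (x.1 • (c - b)) • K' x) (1, 0) +
      (-(F (H x) • p' + p x • K' x)) (0, 1) = 0 := by
    intro x
    simp only [hK', hH', hp', hq', add_apply, smul_apply, neg_apply,
      ContinuousLinearMap.smulRight_apply, ContinuousLinearMap.comp_apply,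
      ContinuousLinearMap.mul_apply', ContinuousLinearMap.coe_fst', ContinuousLinearMap.coe_snd',
      smul_eq_mul, one_smul, zero_smul, smul_zero, zero_add, add_zero, mul_smul_comm,
      smul_mul_assoc]
    have : (c - b) * (F' (H x) * p x) = p x * (F' (H x) * (c - b)) := by ring
    rw [this]; abel
  have key := integral2_divergence_prod_of_hasFDerivAt
    (fun x : ℝ × ℝ => F (H x) * (x.1 • (c - b))) (fun x : ℝ × ℝ => -(F (H x) * p x))
    (fun x => F (H x) • q' + (x.1 • (c - b)) • K' x) (fun x => -(F (H x) • p' + p x • K' x))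
    0 0 1 1 (fun x hx => (hfd x hx).continuousAt.continuousWithinAt)
    (fun x hx => (hgd x hx).continuousAt.continuousWithinAt)
    (fun x hx => hfd x (hsub x hx)) (fun x hx => hgd x (hsub x hx))
    (by simp only [hzero]; exact integrableOn_zero)
  simp only [hzero] at key
  have hc : ∀ {x y : Dual} (z : Dual), (∀ s ∈ [[(0 : ℝ), 1]], x + s • y ∈ TIcc θ a c) →
      ∫ s in (0 : ℝ)..1, F (x + s • y) * z = z * ∫ s in (0 : ℝ)..1, F (x + s • y) := by
    intro x y z hxy
    simp only [mul_comm _ z]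
    have hcont : ContinuousOn (fun s : ℝ => F (x + s • y)) [[(0 : ℝ), 1]] := fun s hs =>
      ((hF _ (hxy s hs)).continuousAt.comp (f := fun s : ℝ => x + s • y)
        (by fun_prop)).continuousWithinAt
    exact (ContinuousLinearMap.mul ℝ Dual z).intervalIntegral_comp_comm
      hcont.intervalIntegrable
  have h01 := uIcc_of_le (zero_le_one (α := ℝ))
  have e1 := hc (x := a) (y := c - a) (c - a) fun s hs => by
    rw [h01] at hs; exact segment_mem_TIcc (hab.trans hbc) hs.1 hs.2
  have e2 := hc (x := a) (y := b - a) (b - a) fun s hs => by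
    rw [h01] at hs
    have := segment_mem_TIcc hab hs.1 hs.2
    exact ⟨this.1, this.2.trans hbc⟩
  have e3 := hc (x := b) (y := c - b) (c - b) fun s hs => by
    rw [h01] at hs
    have := segment_mem_TIcc hbc hs.1 hs.2
    exact ⟨hab.trans this.1, this.2⟩
  -- The side `s = 0` collapses to the vertex `a` and contributes nothing; `s = 1` is the edge from
  -- `b` to `c`, and `t = 0`, `t = 1` are the edges from `a` to `b` and to `c`.
  simp only [hH, hp, zero_smul, one_smul, add_zero, intervalIntegral.integral_zero,
    intervalIntegral.integral_neg, mul_zero, sub_zero, add_sub_cancel, e1, e2, e3] at key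
  rw [← sub_eq_zero]
  refine Eq.trans ?_ key.symm
  abel

/-! ### The mean value of a function on a box times the volume of the box -/

/-- The point with parameters `t` on the diagonal plane of the box `∏ [a i, b i]`. -/
def diag {k : ℕ} (a b : Space k) (t : Fin k → ℝ) : Space k := fun i => a i + t i • (b i - a i)

/-- The integral of `f` over the diagonal plane of the box `∏ [a i, b i]`. -/
def boxInt {k : ℕ} (f : Space k → Dual) (a b : Space k) : Dual :=
  (∏ i, (b i - a i)) * ∫ t in Icc (0 : Fin k → ℝ) 1, f (diag a b t)

theorem continuous_diag {k : ℕ} (a b : Space k) : Continuous (diag a b) := by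
  unfold diag; fun_prop

theorem diag_mem {θ : Kind} {k : ℕ} {a b : Space k} (h : ∀ i, TLe θ (a i) (b i))
    {t : Fin k → ℝ} (ht : t ∈ Icc (0 : Fin k → ℝ) 1) : diag a b t ∈ TRect θ a b :=
  fun i => segment_mem_TIcc (h i) (ht.1 i) (ht.2 i)

theorem integrableOn_diag {θ : Kind} {k : ℕ} {a b : Space k} (h : ∀ i, TLe θ (a i) (b i))
    {f : Space k → Dual} (hf : ContinuousOn f (TRect θ a b)) :
    IntegrableOn (fun t => f (diag a b t)) (Icc (0 : Fin k → ℝ) 1) :=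
  (hf.comp (continuous_diag a b).continuousOn fun _ ht => diag_mem h ht).integrableOn_compact
    isCompact_Icc

theorem diag_insertNth {k : ℕ} (i : Fin (k + 1)) (a b : Space (k + 1)) (s : ℝ) (t : Fin k → ℝ) :
    diag a b (i.insertNth (α := fun _ => ℝ) s t) =
      i.insertNth (α := fun _ => Dual) (a i + s • (b i - a i))
        (diag (i.removeNth a) (i.removeNth b) t) := by
  funext l
  refine Fin.succAboveCases i ?_ (fun l => ?_) l <;> simp [diag, Fin.removeNth]

theorem insertNth_mem_Icc {k : ℕ} (i : Fin (k + 1)) (s : ℝ) (t : Fin k → ℝ) :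
    i.insertNth (α := fun _ => ℝ) s t ∈ Icc (0 : Fin (k + 1) → ℝ) 1 ↔
      s ∈ Icc (0 : ℝ) 1 ∧ t ∈ Icc (0 : Fin k → ℝ) 1 := by
  rw [Fin.insertNth_mem_Icc]; rfl

/-- Fubini's theorem for the unit cube, one coordinate against the others. -/
theorem integral_unitCube_succ {k : ℕ} (i : Fin (k + 1)) {g : (Fin (k + 1) → ℝ) → Dual}
    (hg : IntegrableOn g (Icc 0 1)) :
    Integrable (fun t => ∫ s in (0 : ℝ)..1, g (i.insertNth (α := fun _ => ℝ) s t))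
        (volume.restrict (Icc (0 : Fin k → ℝ) 1)) ∧
      ∫ t in Icc 0 1, g t = ∫ t in Icc (0 : Fin k → ℝ) 1, ∫ s in (0 : ℝ)..1,
        g (i.insertNth (α := fun _ => ℝ) s t) := by
  set e := (MeasurableEquiv.piFinSuccAbove (fun _ : Fin (k + 1) => ℝ) i).symm with he
  have hmp : MeasurePreserving e :=
    (volume_preserving_piFinSuccAbove (fun _ : Fin (k + 1) => ℝ) i).symm _
  have heq : ∀ x, e x = i.insertNth (α := fun _ => ℝ) x.1 x.2 := fun x => rfl
  have hpre : e ⁻¹' Icc 0 1 = Icc (0 : ℝ) 1 ×ˢ Icc (0 : Fin k → ℝ) 1 := by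
    ext x
    rw [mem_preimage, heq, insertNth_mem_Icc, mem_prod]
  have hint : IntegrableOn (g ∘ e) (Icc (0 : ℝ) 1 ×ˢ Icc (0 : Fin k → ℝ) 1) := by
    rw [← hpre, hmp.integrableOn_comp_preimage e.measurableEmbedding]
    exact hg
  have hint' : Integrable (g ∘ e) ((volume.restrict (Icc (0 : ℝ) 1)).prod
      (volume.restrict (Icc (0 : Fin k → ℝ) 1))) := by
    rw [Measure.prod_restrict]; exact hint
  have hs : ∀ t : Fin k → ℝ, ∫ s in (0 : ℝ)..1, g (i.insertNth (α := fun _ => ℝ) s t) =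
      ∫ s in Icc (0 : ℝ) 1, (g ∘ e) (s, t) := fun t => by
    rw [intervalIntegral.integral_of_le zero_le_one, integral_Icc_eq_integral_Ioc]; rfl
  simp only [hs]
  refine ⟨hint'.integral_prod_right, ?_⟩
  rw [← integral_prod_symm _ hint', Measure.prod_restrict, ← hpre]
  exact (hmp.setIntegral_preimage_emb e.measurableEmbedding g (Icc 0 1)).symm

theorem hasFDerivAt_insertNth {k : ℕ} (i : Fin (k + 1)) (x : Space k) (z : Dual) :
    HasFDerivAt (fun z => (i.insertNth (α := fun _ => Dual) z x : Space (k + 1)))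
      (ContinuousLinearMap.single ℝ (fun _ : Fin (k + 1) => Dual) i) z := by
  have : (fun z => (i.insertNth (α := fun _ => Dual) z x : Space (k + 1))) = fun z =>
      ContinuousLinearMap.single ℝ (fun _ : Fin (k + 1) => Dual) i z +
        (i.insertNth (α := fun _ => Dual) 0 x : Space (k + 1)) := by
    funext z l
    refine Fin.succAboveCases i ?_ (fun l => ?_) l <;> simp
  rw [this]
  exact (ContinuousLinearMap.hasFDerivAt _).add_const _

/-- Writing `v` as `v • 1` and using dual linearity shows that the derivative in one dual variable
is multiplication by a partial derivative, the form required by `segment_integral_add`. -/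
theorem DD.hasFDerivAt_insertNth {k : ℕ} {f : Space (k + 1) → Dual} {i : Fin (k + 1)}
    {x : Space k} {z : Dual} (h : DD f (i.insertNth (α := fun _ => Dual) z x)) :
    HasFDerivAt (fun z => f (i.insertNth (α := fun _ => Dual) z x))
      (ContinuousLinearMap.mul ℝ Dual
        (fderiv ℝ f (i.insertNth (α := fun _ => Dual) z x) (Pi.single i 1))) z := by
  refine (h.hasFDerivAt.comp z (DualStokes.hasFDerivAt_insertNth i x z)).congr_fderiv ?_
  refine ContinuousLinearMap.ext fun v => ?_
  have : (Pi.single i v : Space (k + 1)) = v • Pi.single i 1 := by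
    rw [← Pi.single_smul, smul_eq_mul, mul_one]
  simp [this, h.2, mul_comm]

/-- Fubini isolates the line integral along edge `i`, the only factor that changes when that edge is
cut. -/
theorem boxInt_succ {θ : Kind} {k : ℕ} (i : Fin (k + 1)) {a b : Space (k + 1)}
    (h : ∀ i, TLe θ (a i) (b i)) {f : Space (k + 1) → Dual}
    (hf : ContinuousOn f (TRect θ a b)) :
    Integrable (fun t => (b i - a i) * ∫ s in (0 : ℝ)..1, f (i.insertNth (α := fun _ => Dual)
          (a i + s • (b i - a i)) (diag (i.removeNth a) (i.removeNth b) t)))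
        (volume.restrict (Icc (0 : Fin k → ℝ) 1)) ∧
    boxInt f a b = (∏ l, (i.removeNth b l - i.removeNth a l)) *
      ∫ t in Icc (0 : Fin k → ℝ) 1, (b i - a i) * ∫ s in (0 : ℝ)..1,
        f (i.insertNth (α := fun _ => Dual)
          (a i + s • (b i - a i)) (diag (i.removeNth a) (i.removeNth b) t)) := by
  obtain ⟨h1, h2⟩ := integral_unitCube_succ i (integrableOn_diag h hf)
  simp only [diag_insertNth] at h1 h2
  refine ⟨h1.const_mul _, ?_⟩
  rw [boxInt, h2, Fin.prod_univ_succAbove _ i]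
  have := (ContinuousLinearMap.mul ℝ Dual (b i - a i)).integral_comp_comm h1
  simp only [ContinuousLinearMap.mul_apply'] at this
  rw [this, mul_comm (b i - a i), mul_assoc]
  rfl

theorem removeNth_update_same {k : ℕ} (i : Fin (k + 1)) (a : Space (k + 1)) (c : Dual) :
    i.removeNth (Function.update a i c) = i.removeNth a := by
  funext l; simp [Fin.removeNth]

/-- `boxInt` is additive in each edge of the box. -/
theorem boxInt_update_add {θ : Kind} {k : ℕ} (i : Fin k) {a b : Space k} {c : Dual}
    (h : ∀ i, TLe θ (a i) (b i)) (hc : c ∈ TIcc θ (a i) (b i)) {f : Space k → Dual}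
    (hf : ∀ x ∈ TRect θ a b, DD f x) :
    boxInt f a (Function.update b i c) + boxInt f (Function.update a i c) b = boxInt f a b := by
  obtain _ | k := k
  · exact i.elim0
  have hcont : ContinuousOn f (TRect θ a b) := fun x hx =>
    (hf x hx).1.continuousAt.continuousWithinAt
  have hb' : ∀ l, TLe θ (a l) (Function.update b i c l) := fun l => by
    rcases eq_or_ne l i with rfl | hl
    · simpa using hc.1
    · simpa [hl] using h l
  have ha' : ∀ l, TLe θ (Function.update a i c l) (b l) := fun l => by
    rcases eq_or_ne l i with rfl | hl
    · simpa using hc.2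
    · simpa [hl] using h l
  have hs1 : TRect θ a (Function.update b i c) ⊆ TRect θ a b := fun x hx l => by
    refine ⟨(hx l).1, (hx l).2.trans ?_⟩
    rcases eq_or_ne l i with rfl | hl
    · simpa using hc.2
    · simpa [hl] using TLe.refl θ _
  have hs2 : TRect θ (Function.update a i c) b ⊆ TRect θ a b := fun x hx l => by
    refine ⟨TLe.trans ?_ (hx l).1, (hx l).2⟩
    rcases eq_or_ne l i with rfl | hl
    · simpa using hc.1
    · simpa [hl] using TLe.refl θ _
  obtain ⟨i1, e1⟩ := boxInt_succ i hb' (hcont.mono hs1)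
  obtain ⟨i2, e2⟩ := boxInt_succ i ha' (hcont.mono hs2)
  obtain ⟨-, e3⟩ := boxInt_succ i h hcont
  simp only [removeNth_update_same, Function.update_self] at i1 i2 e1 e2
  rw [e1, e2, e3, ← mul_add, ← integral_add i1 i2]
  congr 1
  refine setIntegral_congr_fun measurableSet_Icc fun t ht => ?_
  have hd := diag_mem (a := i.removeNth a) (b := i.removeNth b) (fun l => h (i.succAbove l)) ht
  -- For each fixed position `t` in the other coordinates, the broken path through `c` and the
  -- straight one have equal integrals.
  refine segment_integral_add hc.1 hc.2 (F := fun z => f (i.insertNth (α := fun _ => Dual) z _))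
    fun z hz => (hf _ fun l => ?_).hasFDerivAt_insertNth
  refine Fin.succAboveCases i ?_ (fun l => ?_) l
  · simpa using hz
  · rw [Fin.insertNth_apply_succAbove]; exact hd l

/-! ### Functions of boxes that are additive in each edge -/

theorem TLe_of_chain {θ : Kind} {N : ℕ} {pt : Fin (N + 1) → Dual}
    (h : ∀ j : Fin N, TLe θ (pt j.castSucc) (pt j.succ)) {m n : Fin (N + 1)} (hmn : m ≤ n) :
    TLe θ (pt m) (pt n) := by
  induction n using Fin.induction with
  | zero =>
    obtain rfl : m = 0 := le_antisymm hmn (Fin.zero_le _)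
    exact TLe.refl _ _
  | succ n ihn =>
    rcases eq_or_lt_of_le hmn with rfl | hlt
    · exact TLe.refl _ _
    · exact (ihn (Fin.le_castSucc_iff.2 hlt)).trans (h n)

/-- Induction on the dimension: with the cell of the first coordinate fixed, the remaining
coordinates are summed by the induction hypothesis, and the first coordinate then telescopes.
Additivity is only required for boxes between the two extreme corners. -/
theorem sum_grid_of_additive {θ : Kind} {M : Type*} [AddCommGroup M] {k : ℕ} (N : Fin k → ℕ)
    (pt : (i : Fin k) → Fin (N i + 1) → Dual)
    (hpt : ∀ i j, TLe θ (pt i (Fin.castSucc j)) (pt i j.succ))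
    (G : Space k → Space k → M)
    (hG : ∀ (i : Fin k) (a b : Space k) (c : Dual), (∀ l, TLe θ (pt l 0) (a l)) →
      (∀ l, TLe θ (a l) (b l)) → (∀ l, TLe θ (b l) (pt l (Fin.last _))) →
      c ∈ TIcc θ (a i) (b i) →
      G a (Function.update b i c) + G (Function.update a i c) b = G a b) :
    ∑ j : (i : Fin k) → Fin (N i), G (fun i => pt i (j i).castSucc) (fun i => pt i (j i).succ) =
      G (fun i => pt i 0) fun i => pt i (Fin.last _) := by
  induction k with
  | zero =>
    rw [Fintype.sum_unique]
    congr 1 <;> exact funext fun i => i.elim0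
  | succ k ih =>
    have hmono : ∀ i, ∀ m n : Fin (N i + 1), m ≤ n → TLe θ (pt i m) (pt i n) := fun i _ _ =>
      TLe_of_chain (hpt i)
    set A : Space k := fun i => pt i.succ 0
    set B : Space k := fun i => pt i.succ (Fin.last _)
    have hAB : ∀ l, TLe θ (A l) (B l) := fun l => hmono _ _ _ (Fin.zero_le _)
    have hstep : ∀ j₀ : Fin (N 0), ∑ j : (i : Fin k) → Fin (N i.succ),
        G (Fin.cons (pt 0 j₀.castSucc) fun i => pt i.succ (j i).castSucc)
          (Fin.cons (pt 0 j₀.succ) fun i => pt i.succ (j i).succ) =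
        G (Fin.cons (pt 0 j₀.castSucc) A) (Fin.cons (pt 0 j₀.succ) B) := by
      intro j₀
      refine ih (fun i => N i.succ) (fun i => pt i.succ) (fun i j => hpt i.succ j)
        (fun a b => G (Fin.cons (pt 0 j₀.castSucc) a) (Fin.cons (pt 0 j₀.succ) b)) ?_
      intro i a b c h1 h2 h3 hc
      simp only [Fin.cons_update]
      refine hG i.succ _ _ c (fun l => ?_) (fun l => ?_) (fun l => ?_) (by simpa using hc)
      · refine Fin.cases ?_ (fun l => ?_) l
        · simpa using hmono 0 _ _ (Fin.zero_le _)
        · simpa using h1 l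
      · refine Fin.cases ?_ (fun l => ?_) l
        · simpa using hpt 0 j₀
        · simpa using h2 l
      · refine Fin.cases ?_ (fun l => ?_) l
        · simpa using hmono 0 _ _ (Fin.le_last _)
        · simpa using h3 l
    have hsplit : ∀ x y z : Fin (N 0 + 1), x ≤ y → y ≤ z →
        G (Fin.cons (pt 0 x) A) (Fin.cons (pt 0 y) B) +
          G (Fin.cons (pt 0 y) A) (Fin.cons (pt 0 z) B) =
        G (Fin.cons (pt 0 x) A) (Fin.cons (pt 0 z) B) := by
      intro x y z hxy hyz
      have := hG 0 (Fin.cons (pt 0 x) A) (Fin.cons (pt 0 z) B) (pt 0 y)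
        (fun l => Fin.cases (by simpa using hmono 0 _ _ (Fin.zero_le _))
          (fun l => by simpa using TLe.refl _ _) l)
        (fun l => Fin.cases (by simpa using hmono 0 _ _ (hxy.trans hyz))
          (fun l => by simpa using hAB l) l)
        (fun l => Fin.cases (by simpa using hmono 0 _ _ (Fin.le_last _))
          (fun l => by simpa using TLe.refl _ _) l)
        (by simpa using ⟨hmono 0 _ _ hxy, hmono 0 _ _ hyz⟩)
      simpa using this
    have htel : ∀ m : ℕ, (hm : m ≤ N 0) →
        ∑ j : Fin m, G (Fin.cons (pt 0 (Fin.castLE (by omega) j.castSucc)) A)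
            (Fin.cons (pt 0 (Fin.castLE (by omega) j.succ)) B) =
          G (Fin.cons (pt 0 0) A) (Fin.cons (pt 0 ⟨m, by omega⟩) B) := by
      intro m
      induction m with
      | zero =>
        intro _
        -- The empty sum has to match a box with a degenerate first edge. Cutting that box at its
        -- only point gives `G + G = G`, so its value is zero.
        have := hsplit 0 0 0 le_rfl le_rfl
        simpa using (add_eq_left.1 this).symm
      | succ m ihm =>
        intro hm
        rw [Fin.sum_univ_castSucc]
        refine (congrArg₂ (· + ·) (ihm (by omega)) rfl).trans ?_
        exact hsplit 0 ⟨m, by omega⟩ ⟨m + 1, by omega⟩ (Fin.zero_le _)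
          (Fin.mk_le_mk.2 (Nat.le_succ m))
    rw [← (Fin.consEquiv fun i => Fin (N i)).sum_comp, Fintype.sum_prod_type]
    have hcons : ∀ (q : (i : Fin (k + 1)) → Fin (N i) → Dual) (x : Fin (N 0))
        (y : (i : Fin k) → Fin (N i.succ)),
        (fun i => q i ((Fin.consEquiv fun i => Fin (N i)) (x, y) i)) =
          Fin.cons (q 0 x) fun i => q i.succ (y i) := fun q x y =>
      funext fun i => Fin.cases rfl (fun i => rfl) i
    have hL : ∀ q : (i : Fin (k + 1)) → Dual,
        q = Fin.cons (q 0) fun i => q i.succ := fun q => (Fin.cons_self_tail q).symm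
    rw [hL fun i => pt i 0, hL fun i => pt i (Fin.last _)]
    refine Eq.trans ?_ (htel (N 0) le_rfl)
    refine Finset.sum_congr rfl fun x _ => ?_
    refine Eq.trans (Finset.sum_congr rfl fun y _ => ?_) (hstep x)
    rw [hcons (fun i j => pt i j.castSucc), hcons (fun i j => pt i j.succ)]

theorem sum_boxInt {θ : Kind} {k : ℕ} {a b : Space k} {f : Space k → Dual}
    (hf : ∀ x ∈ TRect θ a b, DD f x) (P : RectPartition θ a b) :
    ∑ j : RectPartition.Index P, boxInt f (fun i => (P i).pt (j i).castSucc)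
      (fun i => (P i).pt (j i).succ) = boxInt f a b := by
  refine (sum_grid_of_additive (θ := θ) (fun i => (P i).N) (fun i => (P i).pt)
    (fun i j => Or.inl ((P i).lt j)) (boxInt f) ?_).trans ?_
  · intro i a' b' c h1 h2 h3 hc
    refine boxInt_update_add i h2 hc fun x hx => hf x fun l => ?_
    have h1 := h1 l
    have h3 := h3 l
    rw [(P l).pt_zero] at h1
    rw [(P l).pt_last] at h3
    exact ⟨h1.trans (hx l).1, (hx l).2.trans h3⟩
  · simp only [fun i => (P i).pt_zero, fun i => (P i).pt_last]

/-! ### Darboux sums of dual differentiable functions -/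

/-- The order is given by two real linear functionals, `Re` and the twisted `Ze`, and both commute
with the integral. -/
theorem TLe_integral {α : Type*} [MeasurableSpace α] {μ : Measure α} {θ : Kind} {f g : α → Dual}
    (hf : Integrable f μ) (hg : Integrable g μ) (h : ∀ᵐ t ∂μ, TLe θ (f t) (g t)) :
    TLe θ (∫ t, f t ∂μ) (∫ t, g t ∂μ) := by
  have hre : ∀ {u : α → Dual}, Integrable u μ → Re (∫ t, u t ∂μ) = ∫ t, Re (u t) ∂μ :=
    fun hu => (reL.integral_comp_comm hu).symm
  have hze : ∀ {u : α → Dual}, Integrable u μ →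
      θ.sgn * Ze (∫ t, u t ∂μ) = ∫ t, θ.sgn * Ze (u t) ∂μ :=
    fun hu => by rw [integral_const_mul]; exact congrArg _ (zeL.integral_comp_comm hu).symm
  rw [TLe_iff, hre hf, hre hg, hze hf, hze hg]
  exact ⟨integral_mono_ae (reL.integrable_comp hf) (reL.integrable_comp hg)
      (h.mono fun t ht => (TLe_iff.1 ht).1),
    integral_mono_ae ((zeL.integrable_comp hf).const_mul _) ((zeL.integrable_comp hg).const_mul _)
      (h.mono fun t ht => (TLe_iff.1 ht).2)⟩

theorem integral_unitCube_const (k : ℕ) (z : Dual) : ∫ _ in Icc (0 : Fin k → ℝ) 1, z = z := by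
  rw [setIntegral_const]
  simp [Measure.real, Real.volume_Icc_pi]

theorem integrableOn_unitCube_const (k : ℕ) (z : Dual) :
    IntegrableOn (fun _ => z) (Icc (0 : Fin k → ℝ) 1) :=
  continuousOn_const.integrableOn_compact isCompact_Icc

/-- The unit cube has measure one, so the integral is an average of values of `f` on the box and
lies above `m`; multiplying by the nonnegative volume keeps the inequality. -/
theorem TLe_boxInt {θ : Kind} {k : ℕ} {a b : Space k} (h : ∀ i, TLe θ (a i) (b i))
    {f : Space k → Dual} (hf : ContinuousOn f (TRect θ a b)) {m : Dual}
    (hm : ∀ x ∈ TRect θ a b, TLe θ m (f x)) : TLe θ (m * ∏ i, (b i - a i)) (boxInt f a b) := by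
  rw [boxInt, mul_comm _ (∫ _ in _, _), ← integral_unitCube_const k m]
  exact (TLe_integral (integrableOn_unitCube_const k m) (integrableOn_diag h hf)
    ((ae_restrict_iff' measurableSet_Icc).2
      (ae_of_all _ fun t ht => hm _ (diag_mem h ht)))).mul_right (TLe.prod_nonneg _ fun i _ => TLe_sub_nonneg.2 (h i))

theorem boxInt_TLe {θ : Kind} {k : ℕ} {a b : Space k} (h : ∀ i, TLe θ (a i) (b i))
    {f : Space k → Dual} (hf : ContinuousOn f (TRect θ a b)) {m : Dual}
    (hm : ∀ x ∈ TRect θ a b, TLe θ (f x) m) : TLe θ (boxInt f a b) (m * ∏ i, (b i - a i)) := by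
  rw [boxInt, mul_comm _ (∫ _ in _, _), ← integral_unitCube_const k m]
  exact (TLe_integral (integrableOn_diag h hf) (integrableOn_unitCube_const k m)
    ((ae_restrict_iff' measurableSet_Icc).2
      (ae_of_all _ fun t ht => hm _ (diag_mem h ht)))).mul_right (TLe.prod_nonneg _ fun i _ => TLe_sub_nonneg.2 (h i))

/-- The greatest lower bound of `f` on `S` for the type `θ` order. -/
def lowerBound {n : ℕ} (f : Space n → Dual) (S : Set (Space n)) : Kind → Dual
  | .one => mkDual (infOn (fun x => Re (f x)) S) (infOn (fun x => Ze (f x)) S)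
  | .two => mkDual (infOn (fun x => Re (f x)) S) (supOn (fun x => Ze (f x)) S)

/-- The least upper bound of `f` on `S` for the type `θ` order. -/
def upperBound {n : ℕ} (f : Space n → Dual) (S : Set (Space n)) : Kind → Dual
  | .one => mkDual (supOn (fun x => Re (f x)) S) (supOn (fun x => Ze (f x)) S)
  | .two => mkDual (supOn (fun x => Re (f x)) S) (infOn (fun x => Ze (f x)) S)

theorem lowerSum_eq {θ : Kind} {n : ℕ} (f : Space n → Dual) {a b : Space n}
    (P : RectPartition θ a b) : lowerSum f θ P =
      ∑ j : RectPartition.Index P, lowerBound f (RectPartition.sub P j) θ *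
        RectPartition.vol P j := by
  cases θ <;> rfl

theorem upperSum_eq {θ : Kind} {n : ℕ} (f : Space n → Dual) {a b : Space n}
    (P : RectPartition θ a b) : upperSum f θ P =
      ∑ j : RectPartition.Index P, upperBound f (RectPartition.sub P j) θ *
        RectPartition.vol P j := by
  cases θ <;> rfl

/-! ### Order bounds of a function on a set -/

section bounds

variable {n : ℕ} {f : Space n → Dual} {S : Set (Space n)}

theorem infOn_le {g : Space n → ℝ} (hS : IsCompact S) (hg : ContinuousOn g S) {x : Space n}
    (hx : x ∈ S) : infOn g S ≤ g x :=
  csInf_le (hS.image_of_continuousOn hg).bddBelow (mem_image_of_mem g hx)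

theorem le_supOn {g : Space n → ℝ} (hS : IsCompact S) (hg : ContinuousOn g S) {x : Space n}
    (hx : x ∈ S) : g x ≤ supOn g S :=
  le_csSup (hS.image_of_continuousOn hg).bddAbove (mem_image_of_mem g hx)

theorem supOn_sub_infOn_le {g : Space n → ℝ} (hne : S.Nonempty) {ρ : ℝ}
    (h : ∀ x ∈ S, ∀ y ∈ S, g x - g y ≤ ρ) : supOn g S - infOn g S ≤ ρ := by
  have hne' := hne.image g
  rw [sub_le_iff_le_add]
  refine csSup_le hne' ?_
  rintro _ ⟨x, hx, rfl⟩
  rw [← sub_le_iff_le_add']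
  refine le_csInf hne' ?_
  rintro _ ⟨y, hy, rfl⟩
  linarith [h x hx y hy]

theorem lowerBound_TLe (θ : Kind) (hS : IsCompact S) (hf : ContinuousOn f S) {x : Space n}
    (hx : x ∈ S) : TLe θ (lowerBound f S θ) (f x) := by
  have h1 : ContinuousOn (fun x => Re (f x)) S := continuous_Re.comp_continuousOn hf
  have h2 : ContinuousOn (fun x => Ze (f x)) S := continuous_Ze.comp_continuousOn hf
  rw [TLe_iff]
  cases θ
  · simpa [lowerBound, Kind.sgn] using And.intro (infOn_le hS h1 hx) (infOn_le hS h2 hx)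
  · simpa [lowerBound, Kind.sgn] using And.intro (infOn_le hS h1 hx) (le_supOn hS h2 hx)

theorem TLe_upperBound (θ : Kind) (hS : IsCompact S) (hf : ContinuousOn f S) {x : Space n}
    (hx : x ∈ S) : TLe θ (f x) (upperBound f S θ) := by
  have h1 : ContinuousOn (fun x => Re (f x)) S := continuous_Re.comp_continuousOn hf
  have h2 : ContinuousOn (fun x => Ze (f x)) S := continuous_Ze.comp_continuousOn hf
  rw [TLe_iff]
  cases θ
  · simpa [upperBound, Kind.sgn] using And.intro (le_supOn hS h1 hx) (le_supOn hS h2 hx)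
  · simpa [upperBound, Kind.sgn] using And.intro (le_supOn hS h1 hx) (infOn_le hS h2 hx)

/-- In twisted coordinates `mkDual 1 θ.sgn` has both entries equal to one, so its multiple by `ρ`
dominates an oscillation of at most `ρ` in each part. -/
theorem upperBound_sub_lowerBound_TLe (θ : Kind) (hne : S.Nonempty) {ρ : ℝ}
    (h : ∀ x ∈ S, ∀ y ∈ S, ‖f x - f y‖ ≤ ρ) :
    TLe θ (upperBound f S θ - lowerBound f S θ) (ρ • mkDual 1 θ.sgn) := by
  have h1 : ∀ x ∈ S, ∀ y ∈ S, Re (f x) - Re (f y) ≤ ρ := fun x hx y hy => by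
    have := h x hx y hy
    rw [dual_norm] at this
    have h' := le_abs_self (Re (f x - f y))
    have h'' := abs_nonneg (Ze (f x - f y))
    rw [Re_sub] at h' this
    linarith
  have h2 : ∀ x ∈ S, ∀ y ∈ S, Ze (f x) - Ze (f y) ≤ ρ := fun x hx y hy => by
    have := h x hx y hy
    rw [dual_norm] at this
    have h' := le_abs_self (Ze (f x - f y))
    have h'' := abs_nonneg (Re (f x - f y))
    rw [Ze_sub] at h' this
    linarith
  have h1' := supOn_sub_infOn_le hne h1
  have h2' := supOn_sub_infOn_le hne h2
  rw [TLe_iff]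
  cases θ <;> simp only [upperBound, lowerBound, Kind.sgn, Re_sub, Ze_sub, Re_mkDual, Ze_mkDual,
    Re_smul, Ze_smul] <;> constructor <;> linarith

end bounds

/-! ### Darboux sums bracket the diagonal integral -/

section partitions

variable {θ : Kind} {k : ℕ} {a b : Space k}

theorem RectPartition.TLe_cell (P : RectPartition θ a b) (j : RectPartition.Index P) (i : Fin k) :
    TLe θ ((P i).pt (j i).castSucc) ((P i).pt (j i).succ) := Or.inl ((P i).lt (j i))

theorem RectPartition.sub_subset (P : RectPartition θ a b) (j : RectPartition.Index P) :
    RectPartition.sub P j ⊆ TRect θ a b := by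
  intro x hx i
  have h0 := TLe_of_chain (fun l => Or.inl ((P i).lt l)) (Fin.zero_le (j i).castSucc)
  have h1 := TLe_of_chain (fun l => Or.inl ((P i).lt l)) (Fin.le_last (j i).succ)
  rw [(P i).pt_zero] at h0
  rw [(P i).pt_last] at h1
  exact ⟨h0.trans (hx i).1, (hx i).2.trans h1⟩

theorem RectPartition.sub_nonempty (P : RectPartition θ a b) (j : RectPartition.Index P) :
    (RectPartition.sub P j).Nonempty :=
  ⟨_, fun i => ⟨TLe.refl _ _, P.TLe_cell j i⟩⟩

theorem RectPartition.vol_nonneg (P : RectPartition θ a b) (j : RectPartition.Index P) :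
    TLe θ 0 (RectPartition.vol P j) :=
  TLe.prod_nonneg _ fun i _ => TLe_sub_nonneg.2 (P.TLe_cell j i)

theorem continuousOn_of_dd {f : Space k → Dual} {S : Set (Space k)} (hf : ∀ x ∈ S, DD f x) :
    ContinuousOn f S := fun x hx => (hf x hx).1.continuousAt.continuousWithinAt

theorem lowerSum_TLe_boxInt {f : Space k → Dual} (hf : ∀ x ∈ TRect θ a b, DD f x)
    (P : RectPartition θ a b) : TLe θ (lowerSum f θ P) (boxInt f a b) := by
  rw [← sum_boxInt hf P, lowerSum_eq]
  refine TLe.sum _ fun j _ => ?_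
  have hc := (continuousOn_of_dd hf).mono (P.sub_subset j)
  exact TLe_boxInt (P.TLe_cell j) hc fun x hx => lowerBound_TLe θ (isCompact_TRect θ _ _) hc hx

theorem boxInt_TLe_upperSum {f : Space k → Dual} (hf : ∀ x ∈ TRect θ a b, DD f x)
    (P : RectPartition θ a b) : TLe θ (boxInt f a b) (upperSum f θ P) := by
  rw [← sum_boxInt hf P, upperSum_eq]
  refine TLe.sum _ fun j _ => ?_
  have hc := (continuousOn_of_dd hf).mono (P.sub_subset j)
  exact boxInt_TLe (P.TLe_cell j) hc fun x hx => TLe_upperBound θ (isCompact_TRect θ _ _) hc hx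

/-- Additivity of `boxInt` for the constant function `1`, whose `boxInt` is the volume. -/
theorem RectPartition.sum_vol (P : RectPartition θ a b) :
    ∑ j, RectPartition.vol P j = ∏ i, (b i - a i) := by
  have := sum_boxInt (f := fun _ => 1) (fun x _ => DD.const 1 x) P
  simp only [boxInt, integral_unitCube_const, mul_one] at this
  exact this

theorem upperSum_sub_lowerSum_TLe {f : Space k → Dual} (P : RectPartition θ a b) {ρ : ℝ}
    (h : ∀ j, ∀ x ∈ RectPartition.sub P j, ∀ y ∈ RectPartition.sub P j, ‖f x - f y‖ ≤ ρ) :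
    TLe θ (upperSum f θ P - lowerSum f θ P) (ρ • (mkDual 1 θ.sgn * ∏ i, (b i - a i))) := by
  rw [upperSum_eq, lowerSum_eq, ← Finset.sum_sub_distrib, ← P.sum_vol, ← smul_mul_assoc,
    Finset.mul_sum]
  refine TLe.sum _ fun j _ => ?_
  rw [← sub_mul]
  exact (upperBound_sub_lowerBound_TLe θ (P.sub_nonempty j) (h j)).mul_right (P.vol_nonneg j)

end partitions

/-! ### Uniform partitions and the value of the integral over the cube -/

theorem bPt_nonneg (θ : Kind) (r : ℝ≥0) : TLe θ 0 (bPt θ r) := by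
  rw [TLe_iff]
  simp [bPt, ← mul_assoc, Kind.sgn_mul_self]

/-- The partition of `[0, b]_θ` into `N` equal intervals. -/
def uniformPartition (θ : Kind) (r : ℝ≥0) {N : ℕ} (hN : 0 < N) : TPartition θ 0 (bPt θ r) where
  N := N
  pt j := ((j : ℝ) / N) • bPt θ r
  pt_zero := by simp
  pt_last := by
    have : (N : ℝ) ≠ 0 := by positivity
    simp [this]
  lt i := by
    have h : ((i.castSucc : ℕ) : ℝ) / N < ((i.succ : ℕ) : ℝ) / N := by
      have : (0 : ℝ) < N := by positivity
      simp only [Fin.val_castSucc, Fin.val_succ, Nat.cast_add, Nat.cast_one]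
      gcongr
      linarith
    have hle : TLe θ (((i.castSucc : ℕ) / N : ℝ) • bPt θ r) (((i.succ : ℕ) / N : ℝ) • bPt θ r) := by
      rw [← TLe_sub_nonneg, ← sub_smul]
      simpa using (bPt_nonneg θ r).smul (sub_nonneg.2 h.le)
    -- Consecutive points differ because the real part of `b` is one, so their real parts are
    -- distinct multiples of `1 / N`.
    refine hle.resolve_right fun he => ?_
    have := congrArg Re he
    simp only [Re_smul, bPt, Re_mkDual, mul_one] at this
    exact h.ne this

theorem uniformPartition_step (θ : Kind) (r : ℝ≥0) {N : ℕ} (hN : 0 < N) (j : Fin N) :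
    (uniformPartition θ r hN).pt j.succ - (uniformPartition θ r hN).pt j.castSucc =
      (N : ℝ)⁻¹ • bPt θ r := by
  have : (N : ℝ) ≠ 0 := by positivity
  change (((j.succ : ℕ) : ℝ) / N) • bPt θ r - (((j.castSucc : ℕ) : ℝ) / N) • bPt θ r = _
  rw [← sub_smul, Fin.val_castSucc, Fin.val_succ, Nat.cast_add, Nat.cast_one]
  congr 1
  field_simp
  ring

theorem norm_sub_le_of_mem_TIcc {θ : Kind} {a b x y : Dual} (hx : x ∈ TIcc θ a b)
    (hy : y ∈ TIcc θ a b) : ‖x - y‖ ≤ ‖b - a‖ := by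
  obtain ⟨hx1, hx2⟩ := hx
  obtain ⟨hy1, hy2⟩ := hy
  rw [TLe_iff] at hx1 hx2 hy1 hy2
  have hs : ∀ p : ℝ, |θ.sgn * p| = |p| := fun p => by cases θ <;> simp [Kind.sgn]
  have key : ∀ p q s t : ℝ, p ≤ s → s ≤ q → p ≤ t → t ≤ q → |s - t| ≤ |q - p| :=
    fun p q s t _ _ _ _ => by
      refine abs_le.2 ⟨?_, ?_⟩ <;> linarith [le_abs_self (q - p)]
  have h1 := key _ _ _ _ hx1.1 hx2.1 hy1.1 hy2.1
  have h2 := key _ _ _ _ hx1.2 hx2.2 hy1.2 hy2.2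
  rw [← mul_sub, ← mul_sub, hs, hs] at h2
  rw [dual_norm, dual_norm]
  exact add_le_add h1 h2

theorem exists_partition_small {θ : Kind} {r : ℝ≥0} {k : ℕ} {f : Space k → Dual}
    (hf : ContinuousOn f (cube θ r k)) {ρ : ℝ} (hρ : 0 < ρ) :
    ∃ P : RectPartition θ (fun _ : Fin k => 0) (fun _ => bPt θ r),
      ∀ j, ∀ x ∈ RectPartition.sub P j, ∀ y ∈ RectPartition.sub P j, ‖f x - f y‖ ≤ ρ := by
  have huc := (isCompact_TRect θ _ _).uniformContinuousOn_of_continuous hf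
  obtain ⟨δ, hδ, h⟩ := Metric.uniformContinuousOn_iff.1 huc ρ hρ
  -- Every edge of the uniform partition has norm `‖b‖ / N < δ`, which bounds the sup distance
  -- inside a subrectangle.
  obtain ⟨N, hN⟩ := exists_nat_gt (‖bPt θ r‖ / δ)
  have hN0 : (0 : ℝ) < N := lt_of_le_of_lt (by positivity) hN
  have hN' : 0 < N := by exact_mod_cast hN0
  refine ⟨fun _ => uniformPartition θ r hN', fun j x hx y hy => ?_⟩
  rw [← dist_eq_norm]
  refine (h x (RectPartition.sub_subset _ j hx) y (RectPartition.sub_subset _ j hy) ?_).le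
  rw [dist_pi_lt_iff hδ]
  intro i
  rw [dist_eq_norm]
  refine (norm_sub_le_of_mem_TIcc (hx i) (hy i)).trans_lt ?_
  have := uniformPartition_step θ r hN' (j i)
  refine (congrArg norm this).trans_lt ?_
  rw [norm_smul, norm_inv, Real.norm_of_nonneg hN0.le, inv_mul_lt_iff₀ hN0]
  rwa [div_lt_iff₀ hδ] at hN

theorem TLe_of_forall_pos {θ : Kind} {x y C : Dual} (h : ∀ ρ : ℝ, 0 < ρ → TLe θ x (y + ρ • C)) :
    TLe θ x y := by
  simp only [TLe_iff, Re_add, Ze_add, Re_smul, Ze_smul, mul_add] at h ⊢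
  have hl : ∀ p q c : ℝ, (∀ ρ : ℝ, 0 < ρ → p ≤ q + ρ * c) → p ≤ q := by
    intro p q c hp
    -- The choice `ρ = η / (|c| + 1)` gives `ρ * c ≤ η` whatever the sign of `c`, including `c = 0`.
    refine le_of_forall_pos_le_add fun η hη => (hp (η / (|c| + 1)) (by positivity)).trans ?_
    have : η / (|c| + 1) * c ≤ η := by
      rw [div_mul_eq_mul_div, div_le_iff₀ (by positivity)]
      nlinarith [le_abs_self c]
    linarith
  exact ⟨hl _ _ (Re C) fun ρ hρ => (h ρ hρ).1,
    hl _ _ (θ.sgn * Ze C) fun ρ hρ => by simpa [mul_left_comm] using (h ρ hρ).2⟩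

theorem nonempty_rectPartition (θ : Kind) (r : ℝ≥0) (k : ℕ) :
    Nonempty (RectPartition θ (fun _ : Fin k => 0) (fun _ => bPt θ r)) :=
  ⟨fun _ => uniformPartition θ r one_pos⟩

/-- The componentwise suprema and infima in the definition form the least upper bound for the type
`θ` order, so the universal property identifies the integral by antisymmetry. -/
theorem lowerIntegral_eq {θ : Kind} {n : ℕ} {f : Space n → Dual} {a b : Space n} {I : Dual}
    [Nonempty (RectPartition θ a b)] (h : ∀ P : RectPartition θ a b, TLe θ (lowerSum f θ P) I)
    (h' : ∀ y, (∀ P : RectPartition θ a b, TLe θ (lowerSum f θ P) y) → TLe θ I y) :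
    lowerIntegral f a b θ = I := by
  simp only [TLe_iff] at h
  cases θ
  all_goals
    refine TLe_antisymm (TLe_iff.2 ?_) (h' _ fun P => TLe_iff.2 ?_)
  all_goals
    simp only [lowerIntegral, Re_mkDual, Ze_mkDual, Kind.sgn, one_mul, neg_mul,
      neg_le_neg_iff] at h ⊢
  · exact ⟨ciSup_le fun P => (h P).1, ciSup_le fun P => (h P).2⟩
  · exact ⟨le_ciSup ⟨_, forall_mem_range.2 fun P => (h P).1⟩ P,
      le_ciSup ⟨_, forall_mem_range.2 fun P => (h P).2⟩ P⟩
  · exact ⟨ciSup_le fun P => (h P).1, le_ciInf fun P => (h P).2⟩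
  · exact ⟨le_ciSup ⟨_, forall_mem_range.2 fun P => (h P).1⟩ P,
      ciInf_le ⟨_, forall_mem_range.2 fun P => (h P).2⟩ P⟩

theorem upperIntegral_eq {θ : Kind} {n : ℕ} {f : Space n → Dual} {a b : Space n} {I : Dual}
    [Nonempty (RectPartition θ a b)] (h : ∀ P : RectPartition θ a b, TLe θ I (upperSum f θ P))
    (h' : ∀ y, (∀ P : RectPartition θ a b, TLe θ y (upperSum f θ P)) → TLe θ y I) :
    upperIntegral f a b θ = I := by
  simp only [TLe_iff] at h
  cases θ
  all_goals
    refine TLe_antisymm (h' _ fun P => TLe_iff.2 ?_) (TLe_iff.2 ?_)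
  all_goals
    simp only [upperIntegral, Re_mkDual, Ze_mkDual, Kind.sgn, one_mul, neg_mul,
      neg_le_neg_iff] at h ⊢
  · exact ⟨ciInf_le ⟨_, forall_mem_range.2 fun P => (h P).1⟩ P,
      ciInf_le ⟨_, forall_mem_range.2 fun P => (h P).2⟩ P⟩
  · exact ⟨le_ciInf fun P => (h P).1, le_ciInf fun P => (h P).2⟩
  · exact ⟨ciInf_le ⟨_, forall_mem_range.2 fun P => (h P).1⟩ P,
      le_ciSup ⟨_, forall_mem_range.2 fun P => (h P).2⟩ P⟩
  · exact ⟨le_ciInf fun P => (h P).1, ciSup_le fun P => (h P).2⟩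

/-- A dual differentiable function is type `θ` integrable on the cube, and its integral is the
integral over the diagonal plane. -/
theorem tIntegral_cube {θ : Kind} {r : ℝ≥0} {k : ℕ} {f : Space k → Dual}
    (hf : ∀ x ∈ cube θ r k, DD f x) :
    TIntegrable θ f (fun _ => 0) (fun _ => bPt θ r) ∧
      tIntegral θ f (fun _ => 0) (fun _ => bPt θ r) =
        boxInt f (fun _ => 0) fun _ => bPt θ r := by
  have hc : ContinuousOn f (cube θ r k) := continuousOn_of_dd hf
  have := nonempty_rectPartition θ r k
  have hl := lowerSum_TLe_boxInt (θ := θ) hf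
  have hu := boxInt_TLe_upperSum (θ := θ) hf
  set I := boxInt f (fun _ => 0) fun _ => bPt θ r
  set C := mkDual 1 θ.sgn * ∏ _i : Fin k, (bPt θ r - 0)
  have hex : ∀ ρ : ℝ, 0 < ρ → ∃ P : RectPartition θ (fun _ : Fin k => 0) (fun _ => bPt θ r),
      TLe θ (upperSum f θ P) (lowerSum f θ P + ρ • C) := by
    intro ρ hρ
    obtain ⟨P, hP⟩ := exists_partition_small hc hρ
    refine ⟨P, ?_⟩
    have := (upperSum_sub_lowerSum_TLe P hP).add (TLe.refl θ (lowerSum f θ P))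
    rwa [sub_add_cancel, add_comm] at this
  have hL : lowerIntegral f (fun _ => 0) (fun _ => bPt θ r) θ = I := by
    -- If `y` bounds all lower sums, then `I ≤ U(P) ≤ L(P) + ρ C ≤ y + ρ C` for a fine partition
    -- `P`, and `ρ` is arbitrary.
    refine lowerIntegral_eq hl fun y hy => TLe_of_forall_pos (C := C) fun ρ hρ => ?_
    obtain ⟨P, hP⟩ := hex ρ hρ
    exact (hu P).trans (hP.trans ((hy P).add (TLe.refl _ _)))
  have hU : upperIntegral f (fun _ => 0) (fun _ => bPt θ r) θ = I := by
    refine upperIntegral_eq hu fun y hy => TLe_of_forall_pos (C := C) fun ρ hρ => ?_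
    obtain ⟨P, hP⟩ := hex ρ hρ
    exact (hy P).trans (hP.trans ((hl P).add (TLe.refl _ _)))
  refine ⟨⟨?_, hL.trans hU.symm⟩, hU⟩
  obtain ⟨M, hM⟩ := (isCompact_TRect θ _ _).exists_bound_of_continuousOn hc
  refine ⟨-M, M, fun x hx => ?_⟩
  have h := hM x hx
  rw [dual_norm] at h
  have h1 := abs_le.1 (show |Re (f x)| ≤ M by linarith [abs_nonneg (Ze (f x))])
  have h2 := abs_le.1 (show |Ze (f x)| ≤ M by linarith [abs_nonneg (Re (f x))])
  exact ⟨h1, h2⟩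

/-! ### The wedge product with a `1`-tensor -/

theorem alternatization_domDomCongr_perm {R M N ι : Type*} [CommRing R] [AddCommGroup M]
    [Module R M] [AddCommGroup N] [Module R N] [Fintype ι] [DecidableEq ι]
    (T : MultilinearMap R (fun _ : ι => M) N) (σ : Equiv.Perm ι) :
    MultilinearMap.alternatization (T.domDomCongr σ) =
      Equiv.Perm.sign σ • MultilinearMap.alternatization T := by
  ext v
  simp only [MultilinearMap.alternatization_apply, AlternatingMap.smul_apply, Finset.smul_sum]
  rw [← Equiv.sum_comp (Equiv.mulRight σ⁻¹)]
  refine Finset.sum_congr rfl fun τ _ => ?_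
  simp only [Equiv.coe_mulRight, MultilinearMap.domDomCongr_apply, smul_smul,
    Equiv.Perm.sign_mul, Equiv.Perm.sign_inv, mul_comm (Equiv.Perm.sign τ)]
  congr 2
  funext i
  simp

theorem alternatization_domDomCongr_apply {R M N ι ι' : Type*} [CommRing R] [AddCommGroup M]
    [Module R M] [AddCommGroup N] [Module R N] [Fintype ι] [DecidableEq ι] [Fintype ι']
    [DecidableEq ι'] (T : MultilinearMap R (fun _ : ι => M) N) (e : ι ≃ ι') (v : ι' → M) :
    MultilinearMap.alternatization (T.domDomCongr e) v =
      MultilinearMap.alternatization T fun i => v (e i) := by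
  simp only [MultilinearMap.alternatization_apply]
  rw [← Equiv.sum_comp e.permCongr]
  refine Finset.sum_congr rfl fun τ _ => ?_
  simp [Equiv.Perm.sign_permCongr]

/-- The wedge product of a `1`-tensor and a tensor, in terms of minors. -/
def minorWedge {n k : ℕ} (u : Space n →ₗ[Dual] Dual) (η : Alt n k) : Alt n (k + 1) :=
  AlternatingMap.alternatizeUncurryFin (u.smulRight η)

theorem minorWedge_apply {n k : ℕ} (u : Space n →ₗ[Dual] Dual) (η : Alt n k)
    (v : Fin (k + 1) → Space n) :
    minorWedge u η v = ∑ j : Fin (k + 1), (-1 : ℤ) ^ (j : ℕ) • (u (v j) * η (j.removeNth v)) := by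
  simp [minorWedge, AlternatingMap.alternatizeUncurryFin_apply]

/-- The minor expansion is a signed sum of `k + 1` permuted copies of `T`, and the sign of each
cycle cancels `(-1) ^ j` under alternatization. Being already alternating, it is multiplied by `(k +
1)!`. Hence `(k + 1)! • minorWedge u η` is `k + 1` times the alternatization of `T`, and `k + 1` is
cancelled over `ℝ`. -/
theorem alternatization_eq_minorWedge {n k : ℕ} (u : Space n →ₗ[Dual] Dual) (η : Alt n k)
    (T : MultilinearMap Dual (fun _ : Fin (k + 1) => Space n) Dual)
    (hT : ∀ v, T v = u (v 0) * η (Fin.tail v)) :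
    MultilinearMap.alternatization T = k ! • minorWedge u η := by
  have hsum : (minorWedge u η : MultilinearMap Dual (fun _ : Fin (k + 1) => Space n) Dual) =
      ∑ j : Fin (k + 1), (-1 : ℤ) ^ (j : ℕ) • T.domDomCongr j.cycleRange.symm := by
    refine MultilinearMap.ext fun v => ?_
    simp only [AlternatingMap.coe_multilinearMap, minorWedge_apply, sum_apply,
      smul_apply, MultilinearMap.domDomCongr_apply, hT, Fin.cycleRange_symm_zero]
    refine Finset.sum_congr rfl fun j _ => ?_
    congr 3
    funext i
    simp [Fin.tail, Fin.removeNth]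
  have h := congrArg MultilinearMap.alternatization hsum
  rw [AlternatingMap.coe_alternatization, map_sum, Fintype.card_fin] at h
  simp only [map_zsmul, alternatization_domDomCongr_perm, Equiv.Perm.sign_symm,
    Fin.sign_cycleRange] at h
  have hone : ∀ j : Fin (k + 1), (-1 : ℤ) ^ (j : ℕ) • ((-1 : ℤˣ) ^ (j : ℕ) •
      MultilinearMap.alternatization T) = MultilinearMap.alternatization T := fun j => by
    rw [Units.smul_def, smul_smul, Units.val_pow_eq_pow_val, Units.val_neg, Units.val_one,
      ← mul_pow]
    simp
  simp only [hone, Finset.sum_const, Finset.card_univ, Fintype.card_fin] at h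
  rw [Nat.factorial_succ, mul_smul] at h
  refine AlternatingMap.ext fun v => ?_
  have hv := congrArg (fun B : Alt n (k + 1) => B v) h
  simp only [AlternatingMap.smul_apply] at hv ⊢
  have hk : ((k + 1 : ℕ) : ℝ) ≠ 0 := by positivity
  rw [← Nat.cast_smul_eq_nsmul ℝ (k + 1), ← Nat.cast_smul_eq_nsmul ℝ (k + 1)] at hv
  exact (smul_right_injective Dual hk hv).symm

/-- The normalizations of the wedge and of `altOf` combine with the `k !` from alternatization to
exactly one. -/
theorem oneWedge_eq {n k : ℕ} (u : Space n →ₗ[Dual] Dual) (η : Alt n k) :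
    oneWedge u η = minorWedge u η := by
  have hT := alternatization_eq_minorWedge u η
    ((tensor (oneForm u).toMultilinearMap η.toMultilinearMap).domDomCongr
      (finCongr (Nat.add_comm 1 k))) (fun v => by
        simp only [tensor, MultilinearMap.domDomCongr_apply, LinearMap.compMultilinearMap_apply,
          MultilinearMap.domCoprod_apply, LinearMap.mul'_apply, oneForm]
        congr 1
        refine congrArg η (funext fun i => congrArg v (Fin.ext ?_))
        simp)
  refine AlternatingMap.ext fun v => ?_
  have hv := congrArg (fun B : Alt n (k + 1) => B v) hT
  simp only [alternatization_domDomCongr_apply, AlternatingMap.smul_apply] at hv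
  simp only [oneWedge, wedge, altOf, AlternatingMap.domDomCongr_apply, AlternatingMap.smul_apply]
  refine (congrArg (fun z => _ • (_ • z)) hv).trans ?_
  rw [smul_smul, ← map_mul, algebraMap_smul, ← Nat.cast_smul_eq_nsmul ℝ (k !), smul_smul]
  have h1 : ((1 + k)! : ℝ) ≠ 0 := by positivity
  have h2 : (k ! : ℝ) ≠ 0 := by positivity
  have : ((1 + k)! : ℝ) / ((1 ! : ℝ) * (k ! : ℝ)) * (1 / ((1 + k)! : ℝ)) * (k ! : ℝ) = 1 := by
    simp
    field_simp
  rw [this, one_smul]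

theorem oneWedge_apply {n k : ℕ} (u : Space n →ₗ[Dual] Dual) (η : Alt n k)
    (v : Fin (k + 1) → Space n) :
    oneWedge u η v = ∑ j : Fin (k + 1), (-1 : ℤ) ^ (j : ℕ) • (u (v j) * η (j.removeNth v)) := by
  rw [oneWedge_eq, minorWedge_apply]

/-! ### The basic tensors -/

/-- The minor expansion of the wedge with a `1`-tensor is the Laplace expansion along the first row.
-/
theorem dx_apply {n k : ℕ} (I : Fin k → Fin n) (v : Fin k → Space n) :
    dx I v = (Matrix.of fun i j => v j (I i)).det := by
  induction k with
  | zero => simp [dx]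
  | succ k ih =>
    rw [dx, oneWedge_apply, Matrix.det_succ_row_zero]
    refine Finset.sum_congr rfl fun j _ => ?_
    rw [ih]
    simp only [LinearMap.proj_apply, Matrix.of_apply, zsmul_eq_mul, Int.cast_pow, Int.cast_neg,
      Int.cast_one, mul_assoc]
    rfl

theorem dx_single_self {n k : ℕ} (I : Fin k ↪o Fin n) :
    dx I (fun j => Pi.single (I j) 1) = 1 := by
  rw [dx_apply]
  convert Matrix.det_one (R := Dual) (n := Fin k) using 2
  ext1 i j
  simp [Matrix.one_apply, Pi.single_apply]

theorem dx_single_of_ne {n k : ℕ} {I J : Fin k ↪o Fin n} (h : I ≠ J) :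
    dx I (fun j => Pi.single (J j) 1) = 0 := by
  -- An increasing tuple is determined by its range, so distinct tuples of equal length have an
  -- index of `I` missing from `J`; the corresponding row of the determinant is zero.
  have hr : ∃ i, I i ∉ Set.range J := by
    by_contra! hc
    have hsub : Set.range I ⊆ Set.range J := Set.range_subset_iff.2 hc
    refine h (OrderEmbedding.range_inj.1 (Set.eq_of_subset_of_ncard_le hsub ?_ (Set.toFinite _)))
    rw [← Set.image_univ, ← Set.image_univ, Set.ncard_image_of_injective _ I.injective,
      Set.ncard_image_of_injective _ J.injective]
  obtain ⟨i, hi⟩ := hr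
  rw [dx_apply]
  refine Matrix.det_eq_zero_of_row_eq_zero i fun j => ?_
  have : I i ≠ J j := fun he => hi ⟨j, he.symm⟩
  simp [this]

theorem alt_sum_apply {n k : ℕ} {ι : Type*} (s : Finset ι) (f : ι → Alt n k)
    (v : Fin k → Space n) : (∑ i ∈ s, f i) v = ∑ i ∈ s, f i v := by
  classical
  induction s using Finset.induction_on with
  | empty => simp
  | insert i s hi ih => rw [Finset.sum_insert hi, Finset.sum_insert hi, AlternatingMap.add_apply, ih]

/-- The coefficients of a differential form are dual differentiable, and determine it. -/
theorem IsDiffForm.coeff {n k : ℕ} {w : Form n k} {A : Set (Space n)} (hw : IsDiffForm w A)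
    (hA : IsOpen A) {p : Space n} (hp : p ∈ A) :
    (∀ I, ∃ L, HasDualDeriv (toSpaceOne (DualStokes.coeff w I)) L p) ∧
      w p = ∑ I, DualStokes.coeff w I p • dx I := by
  obtain ⟨f, hf, hwf⟩ := hw
  have hc : ∀ q ∈ A, ∀ I, DualStokes.coeff w I q = f I q := by
    intro q hq I
    rw [DualStokes.coeff, hwf q hq, alt_sum_apply, Finset.sum_eq_single I]
    · simp [dx_single_self]
    · intro J _ hJ
      simp [dx_single_of_ne hJ]
    · simp
  refine ⟨fun I => ?_, ?_⟩
  · obtain ⟨L, hL⟩ := hf I p hp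
    refine ⟨L, ?_⟩
    have hev : ∀ᶠ x in 𝓝[≠] p, toSpaceOne (f I) x = toSpaceOne (DualStokes.coeff w I) x :=
      nhdsWithin_le_nhds ((hA.eventually_mem hp).mono fun x hx => funext fun _ => (hc x hx I).symm)
    refine Tendsto.congr' ?_ hL
    filter_upwards [hev] with x hx
    rw [hx]
    congr 3
    exact congrArg _ (funext fun _ => (hc p hp I).symm)
  · rw [hwf p hp]
    exact Finset.sum_congr rfl fun I _ => by rw [hc p hp I]

theorem IsDiffForm.coeff_dd {n k : ℕ} {w : Form n k} {A : Set (Space n)} (hw : IsDiffForm w A)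
    (hA : IsOpen A) {p : Space n} (hp : p ∈ A) (I : Fin k ↪o Fin n) :
    DD (DualStokes.coeff w I) p ∧
      ∀ v, differential (DualStokes.coeff w I) p v = fderiv ℝ (DualStokes.coeff w I) p v := by
  obtain ⟨L, hL⟩ := (hw.coeff hA hp).1 I
  refine ⟨hL.dd.apply 0, fun v => ?_⟩
  have h1 := hasFDerivAt_pi'.1 hL.hasFDerivAt 0
  rw [differential, hL.dualDeriv_eq, HasFDerivAt.fderiv (f := DualStokes.coeff w I) h1]
  rfl

theorem d_apply {n k : ℕ} {w : Form n k} {A : Set (Space n)} (hw : IsDiffForm w A)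
    (hA : IsOpen A) {p : Space n} (hp : p ∈ A) (v : Fin (k + 1) → Space n) :
    d w p v = ∑ j : Fin (k + 1), (-1 : ℤ) ^ (j : ℕ) •
      ∑ I : Fin k ↪o Fin n, fderiv ℝ (DualStokes.coeff w I) p (v j) * dx I (j.removeNth v) := by
  rw [d, alt_sum_apply]
  simp only [oneWedge_apply, (hw.coeff_dd hA hp _).2, Finset.smul_sum]
  exact Finset.sum_comm

/-! ### Pullbacks -/

theorem DD.prod {n : ℕ} {ι : Type*} (s : Finset ι) {f : ι → Space n → Dual} {a : Space n}
    (h : ∀ i ∈ s, DD (f i) a) : DD (fun x => ∏ i ∈ s, f i x) a := by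
  classical
  induction s using Finset.induction_on with
  | empty => simpa using DD.const (1 : Dual) a
  | insert i s hi ih =>
    simp only [Finset.prod_insert hi]
    exact (h i (Finset.mem_insert_self _ _)).mul
      (ih fun j hj => h j (Finset.mem_insert_of_mem hj))

theorem DD.dx {m n k : ℕ} (I : Fin k → Fin n) {u : Fin k → Space m → Space n} {a : Space m}
    (h : ∀ j, DD (u j) a) : DD (fun x => DualStokes.dx I fun j => u j x) a := by
  simp only [dx_apply, Matrix.det_apply', Matrix.of_apply]
  exact DD.sum _ fun σ _ => (DD.const _ a).mul (DD.prod _ fun i _ => (h i).apply _)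

/-- Near `p` the function is a polynomial in the coefficients of `w` along `g` and the coordinates
of the `u j`. -/
theorem DD.pullback {m n k : ℕ} {w : Form n k} {A : Set (Space n)} (hw : IsDiffForm w A)
    (hA : IsOpen A) {g : Space m → Space n} {p : Space m} (hg : DD g p) (hp : g p ∈ A)
    {u : Fin k → Space m → Space n} (hu : ∀ j, DD (u j) p) :
    DD (fun x => w (g x) fun j => u j x) p := by
  have hev : ∀ᶠ x in 𝓝 p, g x ∈ A := hg.1.continuousAt.eventually_mem (hA.mem_nhds hp)
  have : DD (fun x => ∑ I : Fin k ↪o Fin n, DualStokes.coeff w I (g x) *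
      DualStokes.dx I fun j => u j x) p :=
    DD.sum _ fun I _ => ((hw.coeff_dd hA hp I).1.comp hg).mul (DD.dx I hu)
  refine this.congr (hev.mono fun x hx => ?_)
  simp only [(hw.coeff hA hx).2, alt_sum_apply, AlternatingMap.smul_apply, smul_eq_mul]

/-- `dx^{i₁} ∧ ⋯ ∧ dx^{i_k}` as a continuous real alternating map. -/
def dxR {n k : ℕ} (I : Fin k → Fin n) : Space n [⋀^Fin k]→L[ℝ] Dual where
  toFun v := dx I v
  map_update_add' v i x y := (dx I).map_update_add v i x y
  map_update_smul' v i c x := by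
    have := (dx I).map_update_smul v i (algebraMap ℝ Dual c) x
    simpa only [algebraMap_smul] using this
  map_eq_zero_of_eq' v i j h hij := (dx I).map_eq_zero_of_eq v h hij
  cont := by
    simp only [dx_apply]
    exact Continuous.matrix_det (by fun_prop)

/-- Multiplication of `dxR I` by dual numbers. -/
def smulDx {n k : ℕ} (I : Fin k → Fin n) : Dual →L[ℝ] Space n [⋀^Fin k]→L[ℝ] Dual :=
  LinearMap.toContinuousLinearMap
    { toFun := fun z => z • dxR I
      map_add' := fun z z' => add_smul z z' _
      map_smul' := fun c z => smul_assoc c z _ }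

@[simp] theorem smulDx_apply {n k : ℕ} (I : Fin k → Fin n) (z : Dual) (v : Fin k → Space n) :
    smulDx I z v = z * dx I v := rfl

/-- A dual-linear map depends linearly on its finitely many values at the standard basis, so
pointwise differentiability upgrades to differentiability as an operator-valued map. -/
theorem differentiableAt_toRealCLM {m n : ℕ} {L : Space m → (Space m →ₗ[Dual] Space n)}
    {p : Space m} (h : ∀ v, DifferentiableAt ℝ (fun a => L a v) p) :
    DifferentiableAt ℝ (fun a => toRealCLM (L a)) p := by
  let S : Fin m → Space n →L[ℝ] (Space m →L[ℝ] Space n) := fun i =>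
    LinearMap.toContinuousLinearMap
      { toFun := fun u => toRealCLM
          ((LinearMap.proj i : Space m →ₗ[Dual] Dual).smulRight u)
        map_add' := fun u u' => ContinuousLinearMap.ext fun v => smul_add (v i) u u'
        map_smul' := fun c u => ContinuousLinearMap.ext fun v => smul_comm (v i) c u }
  have : (fun a => toRealCLM (L a)) = fun a => ∑ i, S i (L a (Pi.single i 1)) := by
    funext a
    refine ContinuousLinearMap.ext fun v => ?_
    rw [sum_apply]
    change L a v = ∑ i, v i • L a (Pi.single i 1)
    conv_lhs => rw [LinearMap.pi_apply_eq_sum_univ (L a) v]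
    refine Finset.sum_congr rfl fun i _ => ?_
    congr 2
    funext j
    simp [Pi.single_apply, eq_comm]
  rw [this]
  have hS : ∀ i, DifferentiableAt ℝ (fun a => S i (L a (Pi.single i 1))) p := fun i =>
    DifferentiableAt.comp (g := S i) p (S i).differentiableAt (h (Pi.single i 1))
  exact DifferentiableAt.fun_sum (A := fun i a => S i (L a (Pi.single i 1))) fun i _ => hS i

/-- The alternating sum of the derivatives of a pulled back form does not involve the second
derivative of the map. -/
theorem sum_fderiv_pullback_real {E F G : Type*} [NormedAddCommGroup E] [NormedSpace ℝ E]
    [NormedAddCommGroup F] [NormedSpace ℝ F] [NormedAddCommGroup G] [NormedSpace ℝ G] {k : ℕ}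
    {ω : F → F [⋀^Fin k]→L[ℝ] G} {ω' : F →L[ℝ] F [⋀^Fin k]→L[ℝ] G} {g : E → F}
    {G' : E → E →L[ℝ] F} {p : E} (hg : ∀ᶠ x in 𝓝 p, HasFDerivAt g (G' x) x)
    (hG' : DifferentiableAt ℝ G' p) (hω : HasFDerivAt ω ω' (g p)) (v : Fin (k + 1) → E) :
    ∑ j : Fin (k + 1), (-1 : ℤ) ^ (j : ℕ) •
        fderiv ℝ (fun x => ω (g x) fun l => G' x (j.removeNth v l)) p (v j) =
      ∑ j : Fin (k + 1), (-1 : ℤ) ^ (j : ℕ) •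
        ω' (G' p (v j)) fun l => G' p (j.removeNth v l) := by
  obtain ⟨G'', hG''⟩ := hG'
  have hsymm : ∀ x y, G'' x y = G'' y x := second_derivative_symmetric_of_eventually hg hG''
  have hη := (hω.comp p hg.self_of_nhds).continuousAlternatingMapCompContinuousLinearMap hG''
  -- The product rule leaves one further term, containing `G''`; its alternating sum vanishes by
  -- symmetry of the second derivative.
  have hz := congrArg (fun B : E [⋀^Fin (k + 1)]→L[ℝ] G => B v)
    (ContinuousAlternatingMap.alternatizeUncurryFin_fderivCompContinuousLinearMap_eq_zero
      (ω (g p)) (G' p) hsymm)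
  simp only [ContinuousAlternatingMap.alternatizeUncurryFin_apply] at hz
  change _ = (0 : G) at hz
  rw [← sub_eq_zero, ← Finset.sum_sub_distrib, ← hz]
  refine Finset.sum_congr rfl fun j _ => ?_
  have h1 : HasFDerivAt (fun x => ω (g x) fun l => G' x (j.removeNth v l)) _ p :=
    (ContinuousAlternatingMap.apply ℝ E G (j.removeNth v)).hasFDerivAt.comp p hη
  rw [h1.fderiv, ← smul_sub]
  congr 1
  rw [sub_eq_iff_eq_add']
  rfl

theorem sum_fderiv_pullback_of_coeff {D E F G ι : Type*} [NormedAddCommGroup D] [NormedSpace ℝ D]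
    [NormedAddCommGroup E] [NormedSpace ℝ E] [NormedAddCommGroup F] [NormedSpace ℝ F]
    [NormedAddCommGroup G] [NormedSpace ℝ G] [Fintype ι] {k : ℕ}
    (T : ι → D →L[ℝ] F [⋀^Fin k]→L[ℝ] G) {f : ι → F → D} {g : E → F}
    {G' : E → E →L[ℝ] F} {p : E} (hg : ∀ᶠ x in 𝓝 p, HasFDerivAt g (G' x) x)
    (hG' : DifferentiableAt ℝ G' p) (hf : ∀ I, DifferentiableAt ℝ (f I) (g p))
    (v : Fin (k + 1) → E) :
    ∑ j : Fin (k + 1), (-1 : ℤ) ^ (j : ℕ) •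
        fderiv ℝ (fun x => ∑ I, T I (f I (g x)) fun l => G' x (j.removeNth v l)) p (v j) =
      ∑ j : Fin (k + 1), (-1 : ℤ) ^ (j : ℕ) •
        ∑ I, T I (fderiv ℝ (f I) (g p) (G' p (v j))) fun l => G' p (j.removeNth v l) := by
  have hω : HasFDerivAt (fun q => ∑ I, T I (f I q))
      (∑ I, (T I).comp (fderiv ℝ (f I) (g p))) (g p) :=
    HasFDerivAt.fun_sum fun I _ => (T I).hasFDerivAt.comp _ (hf I).hasFDerivAt
  simpa only [sum_apply, ContinuousAlternatingMap.sum_apply, ContinuousLinearMap.comp_apply] using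
    sum_fderiv_pullback_real hg hG' hω v

/-- The differential of a pullback is the pullback of the differential. -/
theorem sum_fderiv_pullback {m n k : ℕ} {w : Form n k} {A : Set (Space n)} (hw : IsDiffForm w A)
    (hA : IsOpen A) {g : Space m → Space n} {U : Set (Space m)} (hU : IsOpen U)
    {L : Space m → (Space m →ₗ[Dual] Space n)} (hL : ∀ a ∈ U, HasDualDeriv g (L a) a)
    (hL' : ∀ v, DualDiffOn (fun a => L a v) U) {p : Space m} (hp : p ∈ U) (hgp : g p ∈ A)
    (v : Fin (k + 1) → Space m) :
    ∑ j : Fin (k + 1), (-1 : ℤ) ^ (j : ℕ) •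
        fderiv ℝ (fun x => w (g x) fun l => L x (j.removeNth v l)) p (v j) =
      d w (g p) fun l => L p (v l) := by
  have hLd : ∀ v, DifferentiableAt ℝ (fun a => L a v) p := fun v => by
    obtain ⟨M, hM⟩ := hL' v p hp
    exact hM.dd.1
  have hev : ∀ᶠ x in 𝓝 p, g x ∈ A :=
    (hL p hp).hasFDerivAt.continuousAt.eventually_mem (hA.mem_nhds hgp)
  have key := sum_fderiv_pullback_of_coeff (g := g) (G' := fun x => toRealCLM (L x)) (p := p)
    (fun I : Fin k ↪o Fin n => smulDx I) (f := fun I => coeff w I)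
    ((hU.eventually_mem hp).mono fun x hx => (hL x hx).hasFDerivAt)
    (differentiableAt_toRealCLM hLd) (fun I => (hw.coeff_dd hA hgp I).1.1) v
  simp only [smulDx_apply, toRealCLM_apply] at key
  rw [d_apply hw hA hgp]
  refine Eq.trans (Finset.sum_congr rfl fun j _ => ?_) key
  have h2 : (fun x => w (g x) fun l => L x (j.removeNth v l)) =ᶠ[𝓝 p]
      fun x => ∑ I : Fin k ↪o Fin n, coeff w I (g x) * dx I fun l => L x (j.removeNth v l) :=
    hev.mono fun x hx => by
      simp only [(hw.coeff hA hx).2, alt_sum_apply, AlternatingMap.smul_apply, smul_eq_mul]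
  rw [h2.fderiv_eq]

/-! ### The derivative of an extension of a singular cube -/

/-- A direction that stays in the interval and is invertible as a dual number: towards `b` when `Re
z < 1`, towards `0` otherwise. One such direction suffices even for `r = 0`, when the interval is a
real segment with empty interior. -/
theorem exists_mem_cube_Re_ne {θ : Kind} {r : ℝ≥0} {z : Dual} (hz : z ∈ TIcc θ 0 (bPt θ r)) :
    ∃ y : Dual, Re y ≠ 0 ∧ ∀ t ∈ Icc (0 : ℝ) 1, z + t • y ∈ TIcc θ 0 (bPt θ r) := by
  rcases lt_or_ge (Re z) 1 with h | h
  · refine ⟨bPt θ r - z, ?_, fun t ht => ?_⟩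
    · simp only [Re_sub, bPt, Re_mkDual]
      linarith
    · have := segment_mem_TIcc hz.2 ht.1 ht.2
      exact ⟨hz.1.trans this.1, this.2⟩
  · refine ⟨-z, ?_, fun t ht => ?_⟩
    · rw [Re_neg]
      linarith
    · have := segment_mem_TIcc hz.1 (sub_nonneg.2 ht.2) (sub_le_self 1 ht.1)
      have he : z + t • -z = 0 + (1 - t) • (z - 0) := by
        rw [sub_smul, one_smul, smul_neg, zero_add, sub_zero, sub_eq_add_neg]
      rw [he]
      exact ⟨this.1, this.2.trans hz.2⟩

theorem exists_mul_eq_one {z : Dual} (hz : Re z ≠ 0) : ∃ y, y * z = 1 := by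
  refine ⟨mkDual (Re z)⁻¹ (-Ze z / Re z ^ 2), dual_ext ?_ ?_⟩
  · simp [hz]
  · simp only [Ze_mul, Re_mkDual, Ze_mkDual, Ze_one]
    field_simp
    ring

/-- The derivatives at a point of the cube of two functions that agree on the cube are equal. -/
theorem HasDualDeriv.unique_of_eqOn_cube {θ : Kind} {r : ℝ≥0} {k n : ℕ}
    {g₁ g₂ : Space k → Space n} {L₁ L₂ : Space k →ₗ[Dual] Space n} {p : Space k}
    (h₁ : HasDualDeriv g₁ L₁ p) (h₂ : HasDualDeriv g₂ L₂ p) (h : EqOn g₁ g₂ (cube θ r k))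
    (hp : p ∈ cube θ r k) : L₁ = L₂ := by
  have key : ∀ i, L₁ (Pi.single i 1) = L₂ (Pi.single i 1) := by
    intro i
    obtain ⟨y, hy, hmem⟩ := exists_mem_cube_Re_ne (hp i)
    set v : Space k := Pi.single i y with hv
    have hline : ∀ t ∈ Icc (0 : ℝ) 1, p + t • v ∈ cube θ r k := by
      intro t ht l
      rcases eq_or_ne l i with rfl | hl
      · simpa [hv] using hmem t ht
      · simpa [hv, hl] using hp l
    have hd : ∀ {g : Space k → Space n} {L : Space k →ₗ[Dual] Space n}, HasDualDeriv g L p →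
        HasDerivWithinAt (fun t : ℝ => g (p + t • v)) (L v) (Icc 0 1) 0 := by
      intro g L hg
      have hl : HasDerivAt (fun t : ℝ => p + t • v) v 0 := by
        simpa using ((hasDerivAt_id (0 : ℝ)).smul_const v).const_add p
      have hg' : HasFDerivAt g (toRealCLM L) (p + (0 : ℝ) • v) := by
        simpa using hg.hasFDerivAt
      exact (hg'.comp_hasDerivAt (0 : ℝ) hl).hasDerivWithinAt
    have hLv : L₁ v = L₂ v := by
      -- Both functions agree on the segment, so their one-sided derivatives at its start agree.
      refine (uniqueDiffOn_Icc_zero_one 0 (by simp)).eq_deriv _ (hd h₁) ?_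
      exact (hd h₂).congr (fun t ht => h (hline t ht)) (h (hline 0 (by simp)))
    -- Invertibility of `y` carries the equality from the direction `v` to the basis vector by dual
    -- linearity.
    obtain ⟨z, hz⟩ := exists_mul_eq_one hy
    have hs : (Pi.single i 1 : Space k) = z • v := by
      rw [hv, ← Pi.single_smul, smul_eq_mul, hz]
    rw [hs, map_smul, map_smul, hLv]
  refine LinearMap.pi_ext fun i z => ?_
  have hs : (Pi.single i z : Space k) = z • Pi.single i 1 := by
    rw [← Pi.single_smul, smul_eq_mul, mul_one]
  rw [hs, map_smul, map_smul, key i]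

section

variable {θ : Kind} {r : ℝ≥0} {k n : ℕ} {A : Set (Space n)}

theorem SingularCube.ext_eq (c : SingularCube θ r k A) (x : cube θ r k) : c.ext x = c.toFun x :=
  c.exists_ext.choose_spec.1 x

theorem SingularCube.ext_mem (c : SingularCube θ r k A) {x : Space k} (hx : x ∈ cube θ r k) :
    c.ext x ∈ A := by
  rw [c.ext_eq ⟨x, hx⟩]; exact c.mem _

theorem SingularCube.exists_deriv (c : SingularCube θ r k A) :
    ∃ (U : Set (Space k)) (L : Space k → (Space k →ₗ[Dual] Space n)), IsOpen U ∧
      cube θ r k ⊆ U ∧ (∀ a ∈ U, HasDualDeriv c.ext (L a) a) ∧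
      ∀ v, DualDiffOn (fun a => L a v) U := by
  obtain ⟨U, hU, hcU, L, hL, hL'⟩ := c.exists_ext.choose_spec.2
  exact ⟨U, L, hU, hcU, hL, hL'⟩

theorem topCoeff_pullback_apply (g : Space k → Space n) (w : Form n k) (x : Space k) :
    topCoeff (pullback g w) x = w (g x) fun j => dualDeriv g x (Pi.single j 1) := rfl

/-- The coefficient involves the first derivative of the cube, so its differentiability rests on
that derivative being differentiable too. -/
theorem SingularCube.topCoeff_dd (c : SingularCube θ r k A) (hA : IsOpen A) {w : Form n k}
    (hw : IsDiffForm w A) {x : Space k} (hx : x ∈ cube θ r k) :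
    DD (topCoeff (pullback c.ext w)) x := by
  obtain ⟨U, L, hU, hcU, hL, hL'⟩ := c.exists_deriv
  have hLd : ∀ v, DD (fun a => L a v) x := fun v => by
    obtain ⟨M, hM⟩ := hL' v x (hcU hx)
    exact hM.dd
  have := DD.pullback hw hA (hL x (hcU hx)).dd (c.ext_mem hx)
    (u := fun j a => L a (Pi.single j 1)) fun j => hLd _
  refine this.congr ((hU.eventually_mem (hcU hx)).mono fun y hy => ?_)
  rw [topCoeff_pullback_apply, (hL y hy).dualDeriv_eq]

theorem cubeIntegrable (c : SingularCube θ r k A) (hA : IsOpen A) {w : Form n k}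
    (hw : IsDiffForm w A) : CubeIntegrable w c := by
  cases k with
  | zero => trivial
  | succ k => exact (tIntegral_cube fun x hx => c.topCoeff_dd hA hw hx).1

/-- Including `k = 0`, where the product is empty and the unit cube is a point of measure one, means
that the endpoints of `1`-cubes need no separate treatment. -/
theorem cubeIntegral_eq (c : SingularCube θ r k A) (hA : IsOpen A) {w : Form n k}
    (hw : IsDiffForm w A) :
    cubeIntegral w c =
      boxInt (topCoeff (pullback c.ext w)) (fun _ => 0) fun _ => bPt θ r := by
  cases k with
  | zero =>
    have h0 : ∀ x : Space 0, x ∈ cube θ r 0 := fun x i => i.elim0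
    have hx : ∀ x : Space 0, topCoeff (pullback c.ext w) x =
        w (c.toFun ⟨0, h0 _⟩) Fin.elim0 := fun x => by
      rw [topCoeff_pullback_apply, c.ext_eq ⟨x, h0 x⟩]
      congr 1
      · congr 2
        exact Subtype.ext (funext fun i => i.elim0)
      · exact funext fun i => i.elim0
    simp only [boxInt, hx, integral_unitCube_const]
    simp only [Finset.univ_eq_empty, Finset.prod_empty, one_mul, cubeIntegral]
  | succ k => exact (tIntegral_cube fun x hx => c.topCoeff_dd hA hw hx).2

/-- The extension chosen for a face may differ from the restriction of `c.ext` off the cube, but on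
the cube the values agree, and therefore the derivatives do. -/
theorem SingularCube.topCoeff_face (c : SingularCube θ r (k + 1) A) {w : Form n k}
    {U : Set (Space (k + 1))} {L : Space (k + 1) → (Space (k + 1) →ₗ[Dual] Space n)}
    (hcU : cube θ r (k + 1) ⊆ U) (hL : ∀ a ∈ U, HasDualDeriv c.ext (L a) a) (j : Fin (k + 1))
    (α : Fin 2) {x : Space k} (hx : x ∈ cube θ r k) :
    topCoeff (pullback (c.face j α).ext w) x =
      w (c.ext (faceMap θ r j α x)) fun l =>
        L (faceMap θ r j α x) (Pi.single (j.succAbove l) 1) := by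
  obtain ⟨U', L', -, hcU', hL', -⟩ := (c.face j α).exists_deriv
  have heq : EqOn (c.face j α).ext (fun x => c.ext (faceMap θ r j α x)) (cube θ r k) :=
    fun y hy => ((c.face j α).ext_eq ⟨y, hy⟩).trans (c.ext_eq ⟨_, faceMap_mem θ r j α hy⟩).symm
  have hLL := (hL' x (hcU' hx)).unique_of_eqOn_cube
    (hL _ (hcU (faceMap_mem θ r j α hx))).comp_faceMap heq hx
  rw [topCoeff_pullback_apply, (hL' x (hcU' hx)).dualDeriv_eq, hLL, heq hx]
  refine congrArg _ (funext fun l => congrArg (L _) ?_)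
  funext i
  refine Fin.succAboveCases j ?_ (fun i => ?_) i <;> simp [faceLin, Pi.single_apply]

/-! ### Stokes' theorem -/

/-- The real linear parametrization of the diagonal plane of the cube. -/
def diagCLM (b : Dual) (k : ℕ) : (Fin k → ℝ) →L[ℝ] Space k :=
  ContinuousLinearMap.pi fun i => (ContinuousLinearMap.proj i).smulRight b

theorem diagCLM_apply (b : Dual) (k : ℕ) (t : Fin k → ℝ) :
    diagCLM b k t = diag (fun _ => 0) (fun _ => b) t := by
  funext i; simp [diagCLM, diag]

theorem diagCLM_single (b : Dual) {k : ℕ} (i : Fin k) :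
    diagCLM b k (Pi.single i 1) = b • Pi.single i 1 := by
  funext j
  rcases eq_or_ne j i with rfl | h <;> simp [diagCLM, *]

theorem diag_insertNth_zero_one (j : Fin (k + 1)) (α : Fin 2) (t : Fin k → ℝ) :
    diag (fun _ => 0) (fun _ => bPt θ r) (j.insertNth (α := fun _ => ℝ) (α.val : ℝ) t) =
      faceMap θ r j α (diag (fun _ => 0) (fun _ => bPt θ r) t) := by
  rw [diag_insertNth, faceMap, facePt]
  congr 1
  fin_cases α <;> simp

/-- The divergence theorem over the diagonal plane of the cube. -/
theorem boxInt_divergence {h : Fin (k + 1) → Space (k + 1) → Dual} {F : Space (k + 1) → Dual}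
    (hh : ∀ j, ∀ x ∈ cube θ r (k + 1), DD (h j) x)
    (hF : ContinuousOn F (cube θ r (k + 1)))
    (hdiv : ∀ x ∈ cube θ r (k + 1),
      ∑ j : Fin (k + 1), (-1 : ℤ) ^ (j : ℕ) • fderiv ℝ (h j) x (Pi.single j 1) = F x) :
    boxInt F (fun _ => 0) (fun _ => bPt θ r) = ∑ j : Fin (k + 1), (-1 : ℤ) ^ (j : ℕ) •
      (boxInt (fun x => h j (faceMap θ r j 1 x)) (fun _ => 0) (fun _ => bPt θ r) -
        boxInt (fun x => h j (faceMap θ r j 0 x)) (fun _ => 0) (fun _ => bPt θ r)) := by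
  set b := bPt θ r with hb
  set D : (Fin (k + 1) → ℝ) → Space (k + 1) := diag (fun _ => 0) fun _ => b with hD
  have hmem : ∀ t ∈ Icc (0 : Fin (k + 1) → ℝ) 1, D t ∈ cube θ r (k + 1) := fun t ht =>
    diag_mem (fun _ => bPt_nonneg θ r) ht
  have hmem' : ∀ t ∈ Icc (0 : Fin k → ℝ) 1,
      diag (fun _ => 0) (fun _ => b) t ∈ cube θ r k := fun t ht =>
    diag_mem (fun _ => bPt_nonneg θ r) ht
  have hDd : ∀ t, HasFDerivAt D (diagCLM b (k + 1)) t := fun t => by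
    have : D = diagCLM b (k + 1) := funext fun t => (diagCLM_apply b _ t).symm
    rw [this]
    exact (diagCLM b (k + 1)).hasFDerivAt
  set f : Fin (k + 1) → (Fin (k + 1) → ℝ) → Dual := fun j t =>
    ((-1 : ℝ) ^ (j : ℕ)) • h j (D t) with hf
  set f' : Fin (k + 1) → (Fin (k + 1) → ℝ) → (Fin (k + 1) → ℝ) →L[ℝ] Dual := fun j t =>
    ((-1 : ℝ) ^ (j : ℕ)) • (fderiv ℝ (h j) (D t)).comp (diagCLM b (k + 1)) with hf'
  have hfd : ∀ t ∈ Icc (0 : Fin (k + 1) → ℝ) 1, ∀ j, HasFDerivAt (f j) (f' j t) t :=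
    fun t ht j =>
    HasFDerivAt.fun_const_smul (f := fun t => h j (D t))
      ((hh j _ (hmem t ht)).hasFDerivAt.comp t (hDd t)) ((-1 : ℝ) ^ (j : ℕ))
  have hz : ∀ (m : ℕ) (z : Dual), ((-1 : ℝ) ^ m) • z = ((-1 : ℤ) ^ m) • z := fun m z => by
    rcases neg_one_pow_eq_or ℤ m with hm | hm
    · have : (-1 : ℝ) ^ m = 1 := by exact_mod_cast congrArg (Int.cast : ℤ → ℝ) hm
      rw [hm, this, one_smul, one_smul]
    · have : (-1 : ℝ) ^ m = -1 := by exact_mod_cast congrArg (Int.cast : ℤ → ℝ) hm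
      rw [hm, this, neg_smul, neg_smul, one_smul, one_smul]
  -- The `j`-th real direction is sent to `b` times the `j`-th basis vector, and dual linearity
  -- pulls out the factor `b`.
  have hsum : ∀ t ∈ Icc (0 : Fin (k + 1) → ℝ) 1,
      ∑ j, f' j t (Pi.single j 1) = b * F (D t) := fun t ht => by
    rw [← hdiv _ (hmem t ht), Finset.mul_sum]
    refine Finset.sum_congr rfl fun j _ => ?_
    simp only [hf', smul_apply, ContinuousLinearMap.comp_apply, diagCLM_single,
      (hh j _ (hmem t ht)).2, hz, smul_eq_mul, mul_smul_comm]
  have hFD : IntegrableOn (fun t => F (D t)) (Icc 0 1) :=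
    integrableOn_diag (fun _ => bPt_nonneg θ r) hF
  have key := integral_divergence_of_hasFDerivAt_off_countable' (0 : Fin (k + 1) → ℝ) 1
    zero_le_one f f' ∅ countable_empty
    (fun j t ht => (hfd t ht j).continuousAt.continuousWithinAt)
    (fun t ht j => hfd t ⟨fun i => (ht.1 i trivial).1.le, fun i => (ht.1 i trivial).2.le⟩ j)
    ((integrableOn_congr_fun hsum measurableSet_Icc).2 (hFD.const_mul b))
  rw [setIntegral_congr_fun measurableSet_Icc hsum] at key
  have hbF : ∫ t in Icc (0 : Fin (k + 1) → ℝ) 1, b * F (D t) =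
      b * ∫ t in Icc (0 : Fin (k + 1) → ℝ) 1, F (D t) :=
    (ContinuousLinearMap.mul ℝ Dual b).integral_comp_comm hFD
  rw [hbF] at key
  simp only [boxInt, sub_zero, Finset.prod_const, Finset.card_univ, Fintype.card_fin]
  -- One factor of the volume `b ^ (k + 1)` is absorbed by the divergence, leaving the volume `b ^
  -- k` of a face.
  rw [pow_succ, mul_assoc]
  refine (congrArg (b ^ k * ·) key).trans ?_
  simp only [Finset.mul_sum, ← mul_sub, ← mul_smul_comm]
  refine Finset.sum_congr rfl fun j _ => congrArg (b ^ k * ·) ?_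
  have hface : ∀ α : Fin 2, ∫ t in Icc (0 : Fin k → ℝ) 1,
      f j (j.insertNth (α := fun _ => ℝ) (α.val : ℝ) t) = ((-1 : ℤ) ^ (j : ℕ)) •
        ∫ t in Icc (0 : Fin k → ℝ) 1, h j (faceMap θ r j α (diag (fun _ => 0) (fun _ => b) t)) := by
    intro α
    rw [← hz, ← integral_smul]
    refine integral_congr_ae (ae_of_all _ fun t => ?_)
    simp only [hf, hD, hb, diag_insertNth_zero_one]
  rw [smul_sub, ← hface 0, ← hface 1]
  simp only [Fin.val_zero, Fin.val_one, Nat.cast_zero, Nat.cast_one]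
  rfl

theorem boxInt_congr {f g : Space k → Dual} (h : EqOn f g (cube θ r k)) :
    boxInt f (fun _ => 0) (fun _ => bPt θ r) = boxInt g (fun _ => 0) fun _ => bPt θ r := by
  rw [boxInt, boxInt]
  congr 1
  exact setIntegral_congr_fun measurableSet_Icc fun t ht =>
    h (diag_mem (fun _ => bPt_nonneg θ r) ht)

/-- Stokes' theorem for a singular cube. -/
theorem cubeIntegral_d (c : SingularCube θ r (k + 1) A) (hA : IsOpen A) {w : Form n k}
    (hw : IsDiffForm w A) (hdw : IsDiffForm (d w) A) :
    cubeIntegral (d w) c = ∑ j : Fin (k + 1), (-1 : ℤ) ^ (j : ℕ) •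
      (cubeIntegral w (c.face j 1) - cubeIntegral w (c.face j 0)) := by
  obtain ⟨U, L, hU, hcU, hL, hL'⟩ := c.exists_deriv
  simp only [cubeIntegral_eq _ hA hw, cubeIntegral_eq _ hA hdw]
  -- `h j` is the coefficient of the pulled back form on the basis vectors other than the `j`-th.
  set h : Fin (k + 1) → Space (k + 1) → Dual := fun j x =>
    w (c.ext x) fun l => L x (Pi.single (j.succAbove l) 1) with hh
  rw [boxInt_divergence (h := h)]
  · refine Finset.sum_congr rfl fun j _ => ?_
    rw [boxInt_congr fun x hx => c.topCoeff_face (w := w) hcU hL j 1 hx,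
      boxInt_congr fun x hx => c.topCoeff_face (w := w) hcU hL j 0 hx]
  · intro j x hx
    refine DD.pullback hw hA (hL x (hcU hx)).dd (c.ext_mem hx)
      (u := fun l a => L a (Pi.single (j.succAbove l) 1)) fun l => ?_
    obtain ⟨M, hM⟩ := hL' (Pi.single (j.succAbove l) 1) x (hcU hx)
    exact hM.dd
  -- Differentiability of `dw` enters here: it makes the divergence continuous, hence integrable.
  · exact continuousOn_of_dd fun x hx => c.topCoeff_dd hA hdw hx
  · intro x hx
    rw [topCoeff_pullback_apply, (hL x (hcU hx)).dualDeriv_eq]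
    exact sum_fderiv_pullback hw hA hU hL hL' (hcU hx) (c.ext_mem hx) fun j => Pi.single j 1

/-- The integral over chains as a homomorphism. -/
def chainIntegralHom (w : Form n k) : Chain θ r k A →ₗ[ℤ] Dual :=
  Finsupp.linearCombination ℤ fun s => cubeIntegral w s

theorem chainIntegralHom_apply (w : Form n k) (c : Chain θ r k A) :
    chainIntegralHom w c = chainIntegral w c := rfl

theorem chainIntegral_boundary (w : Form n k) (c : SingularCube θ r (k + 1) A) :
    chainIntegral w c.boundary = ∑ j : Fin (k + 1), (-1 : ℤ) ^ (j : ℕ) •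
      (cubeIntegral w (c.face j 1) - cubeIntegral w (c.face j 0)) := by
  rw [← chainIntegralHom_apply, SingularCube.boundary, map_sum]
  refine Finset.sum_congr rfl fun j _ => ?_
  rw [Fin.sum_univ_two, map_add]
  -- With `j` counted from zero the sign is `(-1) ^ (j + 1 + α)`, so the face `α = 1` carries `(-1)
  -- ^ j` and the face `α = 0` its negative.
  simp only [chainIntegralHom, Finsupp.linearCombination_single, Fin.val_zero, Fin.val_one,
    pow_succ, add_zero, mul_neg, mul_one, neg_neg, neg_smul, smul_sub]
  abel

end

end DualStokes

end

/-! ### Stokes' theorem for chains, by additivity -/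

theorem proposition6p1 (θ : DualStokes.Kind) (r : NNReal) (n k : ℕ)
    (A : Set (DualStokes.Space n)) (hA : IsOpen A)
    (w : DualStokes.Form n k)
    (hw : DualStokes.IsDiffForm w A)
    (hdw : DualStokes.IsDiffForm (DualStokes.d w) A)
    (c : DualStokes.Chain θ r (k + 1) A) :
    DualStokes.ChainIntegrable (DualStokes.d w) c ∧
      DualStokes.ChainIntegrable w c.boundary ∧
      DualStokes.chainIntegral (DualStokes.d w) c = DualStokes.chainIntegral w c.boundary := by
  refine ⟨fun s _ => DualStokes.cubeIntegrable s hA hdw,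
    fun s _ => DualStokes.cubeIntegrable s hA hw, ?_⟩
  rw [← DualStokes.chainIntegralHom_apply w, DualStokes.Chain.boundary, Finsupp.sum, map_sum,
    DualStokes.chainIntegral, Finsupp.sum]
  refine Finset.sum_congr rfl fun s _ => ?_
  rw [map_zsmul, DualStokes.chainIntegralHom_apply, DualStokes.chainIntegral_boundary,
    DualStokes.cubeIntegral_d s hA hw hdw]
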